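/- Let $\Omega\subset\mathbb R^2$ be a bounded measurable region with a measurable density $\rho$ satisfying $0<\underline\rho\le\rho\le\bar\rho$ on $\Omega$, and let $N\ge 1$ agents be indexed cyclically modulo $N$. Agent $i$ has a position $p_i\in\mathbb R^2$, a reference point $r_i\in\mathbb R^2$ and a phase angle $\varphi_i$ (a real lift of an angle modulo $2\pi$). Its subregion $\Omega_i$ consists of the points $r_i+\kappa(\cos\theta,\sin\theta)\in\Omega$ with $\kappa\ge 0$ and $\varphi_i\le\theta\le\varphi_{i+1}$, where $\varphi_{N+1}=\varphi_1+2\pi$. For a set $D$ of positive mass write $m_D=\int_D\rho\,dq$ and $c_D=m_D^{-1}\int_D q\,\rho(q)\,dq$, and put $m_i=m_{\Omega_i}$. Let $\kappa_\varphi,\kappa_r,\kappa_p>0$ and let $(\varphi,r)$ be a classical solution on $[0,\infty)$ of $$\dot\varphi_i=-\kappa_\varphi\Big[(2m_i-m_{i-1}-m_{i+1})\tfrac{\partial m_i}{\partial\varphi_i}+(2m_{i-1}-m_{i-2}-m_i)\tfrac{\partial m_{i-1}}{\partial\varphi_i}\Big],$$ $$\dot r_i=-\kappa_r\Big[(2m_i-m_{i-1}-m_{i+1})\nabla_{r_i}m_i+(2r_i-r_{i-1}-r_{i+1})\Big]$$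 such that at all times $t\ge 0$ the pointers are in cyclic order, $\varphi_i(t)<\varphi_{i+1}(t)$ for all $i$ (with $\varphi_{N+1}=\varphi_1+2\pi$), the workloads $m_i$ are differentiable functions of $(\varphi,r)$ at $(\varphi(t),r(t))$, and all reference points lie in a fixed compact subset of the interior of $\Omega$. Take the quadratic cost $f(p,q)=\|p-q\|^2$, so that the local cost is $J_{\Omega_i}(p)=\int_{\Omega_i}\|p-q\|^2\rho(q)\,dq$, and let the local optimum $p_i^*(t)$ be a minimiser of $J_{\Omega_i(t)}$ over its critical points in a set $A_i(t)\subset\mathbb R^2$ of allowed positions ($A_i(t)=\Omega_i(t)$, or any other choice for which such a minimiser exists). Let the positions satisfy $\dot p_i=u_i=-\kappa_p(p_i-p_i^*)$ on $[0,\infty)$. Then: 1. For all $t\ge 0$ and all $i$: $m_i>0$; $\nabla J_{\Omega_i}(x)=2m_i(x-c_{\Omega_i})$ and the Hessian of $J_{\Omega_i}$ is $2m_iI$ at every $x\in\mathbb R^2$; $c_{\Omega_i}$ is the unique global minimiser of $J_{\Omega_i}$; for every $B\subset\mathbb R^2$, a point $x$ minimises $J_{\Omega_i}$ over its critical points in $B$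 if and only if $x=c_{\Omega_i}\in B$; and $p_i^*=c_{\Omega_i}$. 2. $\lim_{t\to\infty}\|p_i(t)-c_{\Omega_i(t)}\|=0$ for all $i$. 3. The limits $\lim_{t\to\infty}\varphi_i(t)$ and $\lim_{t\to\infty}r_i(t)$ exist for all $i$, the subregions $\Omega_i^\infty$ that they determine have positive mass, and $\lim_{t\to\infty}p_i(t)=c_{\Omega_i^\infty}$ for all $i$. -/

import Mathlib

open Filter Topology MeasureTheory

namespace Coverage

noncomputable section

/-- The Euclidean plane. -/
abbrev Plane := EuclideanSpace ℝ (Fin 2)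

/-- The unit direction vector with phase angle `θ`. -/
def dir (θ : ℝ) : Plane := !₂[Real.cos θ, Real.sin θ]

/-- The closed sector swept counterclockwise by the rotary pointer with apex `x` from the phase
angle `α` to the phase angle `β`. -/
def sector (x : Plane) (α β : ℝ) : Set Plane :=
  {q | ∃ κ : ℝ, 0 ≤ κ ∧ ∃ θ ∈ Set.Icc α β, q = x + κ • dir θ}

/-- The phase angle that follows `φ i` in cyclic order. The phase angles are real lifts of angles
modulo `2π`, so that one turn is added when the index wraps around. Index arithmetic in `Fin N`
is modulo `N`. -/
def nextAngle {N : ℕ} [NeZero N] (φ : Fin N → ℝ) (i : Fin N) : ℝ :=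
  φ (i + 1) + if i + 1 = 0 then 2 * Real.pi else 0

/-- The subregion of agent `i`: the part of `Ω` between the pointer with phase angle `φ i` and the
next pointer, both based at the reference point `r i`. -/
def subregion {N : ℕ} [NeZero N] (Ω : Set Plane) (φ : Fin N → ℝ) (r : Fin N → Plane)
    (i : Fin N) : Set Plane :=
  Ω ∩ sector (r i) (φ i) (nextAngle φ i)

/-- The mass of the set `D` for the density `ρ`. -/
def mass (ρ : Plane → ℝ) (D : Set Plane) : ℝ := ∫ q in D, ρ q

/-- The `ρ`-weighted centroid of the set `D`. -/
def centroid (ρ : Plane → ℝ) (D : Set Plane) : Plane := (mass ρ D)⁻¹ • ∫ q in D, ρ q • q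

/-- The workload of agent `i`, as a function of all phase angles and all reference points. -/
def workload {N : ℕ} [NeZero N] (Ω : Set Plane) (ρ : Plane → ℝ) (φ : Fin N → ℝ)
    (r : Fin N → Plane) (i : Fin N) : ℝ :=
  mass ρ (subregion Ω φ r i)

/-- The partial derivative of the workload of agent `j` in the phase angle `φ i`. -/
def workloadDerivPhase {N : ℕ} [NeZero N] (Ω : Set Plane) (ρ : Plane → ℝ) (φ : Fin N → ℝ)
    (r : Fin N → Plane) (j i : Fin N) : ℝ :=
  deriv (fun s => workload Ω ρ (Function.update φ i s) r j) (φ i)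

/-- The partial gradient of the workload of agent `i` in its own reference point `r i`. -/
def workloadGradPoint {N : ℕ} [NeZero N] (Ω : Set Plane) (ρ : Plane → ℝ) (φ : Fin N → ℝ)
    (r : Fin N → Plane) (i : Fin N) : Plane :=
  gradient (fun x => workload Ω ρ φ (Function.update r i x) i) (r i)

/-- The right-hand side of the dynamics of the phase angle of agent `i`. -/
def phaseVelocity {N : ℕ} [NeZero N] (Ω : Set Plane) (ρ : Plane → ℝ) (κφ : ℝ) (φ : Fin N → ℝ)
    (r : Fin N → Plane) (i : Fin N) : ℝ :=
  let m : Fin N → ℝ := (workload Ω ρ φ r);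
  (-κφ) * ((2 * m i - m (i - 1) - m (i + 1)) * workloadDerivPhase Ω ρ φ r i i
    + (2 * m (i - 1) - m (i - 2) - m i) * workloadDerivPhase Ω ρ φ r (i - 1) i)

/-- The right-hand side of the dynamics of the reference point of agent `i`. -/
def pointVelocity {N : ℕ} [NeZero N] (Ω : Set Plane) (ρ : Plane → ℝ) (κr : ℝ) (φ : Fin N → ℝ)
    (r : Fin N → Plane) (i : Fin N) : Plane :=
  let m : Fin N → ℝ := (workload Ω ρ φ r);
  (-κr) • ((2 * m i - m (i - 1) - m (i + 1)) • workloadGradPoint Ω ρ φ r i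
    + ((2 : ℝ) • r i - r (i - 1) - r (i + 1)))

/-- `(φ, r)` is a classical solution on `[0, ∞)` of the partition dynamics. The pointers keep
their cyclic order, so that consecutive ones bound genuine sectors whose opening angles add up to
`2π`, and the workloads are differentiable at the states visited, so that the partial derivatives
on the right-hand sides exist. -/
structure IsPartitionSolution {N : ℕ} [NeZero N] (Ω : Set Plane) (ρ : Plane → ℝ) (κφ κr : ℝ)
    (φ : ℝ → Fin N → ℝ) (r : ℝ → Fin N → Plane) : Prop where
  ordered : ∀ t, 0 ≤ t → ∀ i, φ t i < nextAngle (φ t) i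
  differentiable : ∀ t, 0 ≤ t → ∀ i, DifferentiableAt ℝ
    (fun s : (Fin N → ℝ) × (Fin N → Plane) => workload Ω ρ s.1 s.2 i) (φ t, r t)
  phase : ∀ t, 0 ≤ t → ∀ i, HasDerivWithinAt (fun s => φ s i)
    (phaseVelocity Ω ρ κφ (φ t) (r t) i) (Set.Ici 0) t
  point : ∀ t, 0 ≤ t → ∀ i, HasDerivWithinAt (fun s => r s i)
    (pointVelocity Ω ρ κr (φ t) (r t) i) (Set.Ici 0) t

/-- The local cost of serving the set `D` from the position `p`, for the cost function `f`. -/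
def localCost (f : Plane → Plane → ℝ) (ρ : Plane → ℝ) (D : Set Plane) (p : Plane) : ℝ :=
  ∫ q in D, f p q * ρ q

/-- The quadratic cost function. -/
def quadCost (p q : Plane) : ℝ := ‖p - q‖ ^ 2

/-- The critical points of the local cost of `D` among the positions in `A`. -/
def admissibleSet (f : Plane → Plane → ℝ) (ρ : Plane → ℝ) (D A : Set Plane) : Set Plane :=
  {p | p ∈ A ∧ HasGradientAt (localCost f ρ D) 0 p}

/-- `p` minimises the local cost of `D` over its critical points in `A`. The local optimum of the
subregion `D` itself is the case `A = D`; the case `A = Set.univ` puts no constraint on the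
position. -/
def IsLocalOptimum (f : Plane → Plane → ℝ) (ρ : Plane → ℝ) (D A : Set Plane) (p : Plane) :
    Prop :=
  p ∈ admissibleSet f ρ D A ∧ ∀ x ∈ admissibleSet f ρ D A, localCost f ρ D p ≤ localCost f ρ D x

/-- The control input: proportional feedback towards the target `pstar`. -/
def control (κp : ℝ) (p pstar : Plane) : Plane := (-κp) • (p - pstar)

end

end Coverage

open Coverage

namespace Coverage

/-! The partition dynamics is the gradient flow, with gains κφ and κr, of half the energy H = ∑ (m i
- m (i - 1))² + ∑ ‖r i - r (i - 1)‖². Write e and l for the cyclic Laplacians of m and r, a i and b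
i for the rates at which pointer i takes mass from sector i and gives it to sector i - 1, and g i
for the gradient of m i in r i. Then dH/dt is -2 times κφ ∑ (a i * e i - b i * e (i - 1))² + κr ∑ ‖e
i • g i + l i‖² (`hasDerivWithinAt_energy`).

The reference points keep a fixed distance δ from the complement of Ω, so a thin slice has mass at
least proportional to its opening. With the Lipschitz dependence of sector integrals on angles and
apex, this confines a and b to a compact interval of positive numbers and bounds g. If a i * e i = b
i * e (i - 1) around the cycle, all entries of e have the same sign; since they sum to zero, e = 0.
Compactness makes this quantitative (`exists_cyclic_coercive`), and with the spectral gap of the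
cycle the dissipation dominates a multiple of H (`exists_dissipation_bound`).

So H decays exponentially. The velocities are O(√H), hence the angles and reference points converge
(`exists_velocity_decay`). In the limit all workloads are equal, and as the openings add up to 2π
none of them vanishes. The centroids therefore converge. By the parallel axis identity the local
optimum is the centroid, and proportional feedback follows a convergent target to its limit
(`tendsto_of_control`). -/

/-! ### Rotated frames and polar coordinates in the plane -/

/-- The coordinate of `q` in the direction with phase angle `α`. -/
noncomputable def along (α : ℝ) (q : Plane) : ℝ := Real.cos α * q 0 + Real.sin α * q 1

/-- The coordinate of `q` in the direction with phase angle `α + π / 2`. -/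
noncomputable def perp (α : ℝ) (q : Plane) : ℝ := Real.cos α * q 1 - Real.sin α * q 0

lemma dir_zero_coord (θ : ℝ) : dir θ 0 = Real.cos θ := rfl

lemma dir_one_coord (θ : ℝ) : dir θ 1 = Real.sin θ := rfl

lemma along_sub (α : ℝ) (q q' : Plane) : along α (q - q') = along α q - along α q' := by
  simp only [along, PiLp.sub_apply]; ring

lemma perp_sub (α : ℝ) (q q' : Plane) : perp α (q - q') = perp α q - perp α q' := by
  simp only [perp, PiLp.sub_apply]; ring

lemma perp_smul_dir (α κ θ : ℝ) : perp α (κ • dir θ) = κ * Real.sin (θ - α) := by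
  simp only [perp, PiLp.smul_apply, dir_zero_coord, dir_one_coord, Real.sin_sub, smul_eq_mul]; ring

lemma norm_sq_coord (q : Plane) : ‖q‖ ^ 2 = q 0 ^ 2 + q 1 ^ 2 := by
  rw [EuclideanSpace.norm_sq_eq, Fin.sum_univ_two]; simp

lemma along_sq_add_perp_sq (α : ℝ) (q : Plane) : along α q ^ 2 + perp α q ^ 2 = ‖q‖ ^ 2 := by
  rw [norm_sq_coord, along, perp]
  linear_combination (q 0 ^ 2 + q 1 ^ 2) * Real.sin_sq_add_cos_sq α

lemma abs_perp_le (α : ℝ) (q : Plane) : |perp α q| ≤ ‖q‖ := by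
  apply abs_le_of_sq_le_sq _ (norm_nonneg q)
  nlinarith [along_sq_add_perp_sq α q, sq_nonneg (along α q)]

lemma abs_along_le (α : ℝ) (q : Plane) : |along α q| ≤ ‖q‖ := by
  apply abs_le_of_sq_le_sq _ (norm_nonneg q)
  nlinarith [along_sq_add_perp_sq α q, sq_nonneg (perp α q)]

lemma norm_dir (θ : ℝ) : ‖dir θ‖ = 1 := by
  have h := norm_sq_coord (dir θ)
  rw [dir_zero_coord, dir_one_coord, Real.cos_sq_add_sin_sq] at h
  exact (pow_eq_one_iff_of_nonneg (norm_nonneg _) two_ne_zero).1 h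

lemma norm_smul_dir {κ : ℝ} (hκ : 0 ≤ κ) (θ : ℝ) : ‖κ • dir θ‖ = κ := by
  rw [norm_smul, norm_dir, mul_one, Real.norm_of_nonneg hκ]

lemma plane_ext {q q' : Plane} (h0 : q 0 = q' 0) (h1 : q 1 = q' 1) : q = q' := by
  ext i; fin_cases i
  · exact h0
  · exact h1

/-- Polar coordinates with the phase angle in a prescribed half-open interval. -/
lemma exists_eq_smul_dir (α : ℝ) (v : Plane) :
    ∃ κ : ℝ, 0 ≤ κ ∧ ∃ θ ∈ Set.Ico α (α + 2 * Real.pi), v = κ • dir θ := by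
  let z : ℂ := ⟨v 0, v 1⟩
  have hc : Real.cos (toIcoMod Real.two_pi_pos α z.arg) = Real.cos z.arg := by
    rw [toIcoMod, zsmul_eq_mul, Real.cos_sub_int_mul_two_pi]
  have hs : Real.sin (toIcoMod Real.two_pi_pos α z.arg) = Real.sin z.arg := by
    rw [toIcoMod, zsmul_eq_mul, Real.sin_sub_int_mul_two_pi]
  refine ⟨‖z‖, norm_nonneg z, _, toIcoMod_mem_Ico Real.two_pi_pos α z.arg, plane_ext ?_ ?_⟩
  · rw [PiLp.smul_apply, dir_zero_coord, hc, smul_eq_mul, Complex.norm_mul_cos_arg]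
  · rw [PiLp.smul_apply, dir_one_coord, hs, smul_eq_mul, Complex.norm_mul_sin_arg]

/-- The isometry that expresses a vector in the frame whose first axis has phase angle `α`. -/
noncomputable def frame (α : ℝ) : Plane ≃ₗᵢ[ℝ] Plane :=
  LinearIsometry.toLinearIsometryEquiv
    { toFun := fun q => !₂[along α q, perp α q]
      map_add' := fun q q' => by
        apply plane_ext <;> simp [along, perp] <;> ring
      map_smul' := fun c q => by
        apply plane_ext <;> simp [along, perp] <;> ring
      norm_map' := fun q => by
        apply (sq_eq_sq₀ (norm_nonneg _) (norm_nonneg _)).1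
        rw [norm_sq_coord, ← along_sq_add_perp_sq α q]
        simp } rfl

lemma volume_frame_rect (α a b c d : ℝ) :
    volume {q : Plane | along α q ∈ Set.Icc a b ∧ perp α q ∈ Set.Icc c d}
      = ENNReal.ofReal (b - a) * ENNReal.ofReal (d - c) := by
  let S : Set (Fin 2 → ℝ) := Set.pi Set.univ ![Set.Icc a b, Set.Icc c d]
  have hS : MeasurableSet S := by
    refine MeasurableSet.univ_pi fun i => ?_
    fin_cases i
    · exact measurableSet_Icc
    · exact measurableSet_Icc
  have hmp := (PiLp.volume_preserving_ofLp (Fin 2)).comp (frame α).measurePreserving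
  have hpre : {q : Plane | along α q ∈ Set.Icc a b ∧ perp α q ∈ Set.Icc c d}
      = ((@WithLp.ofLp 2 (Fin 2 → ℝ)) ∘ (frame α)) ⁻¹' S := by
    ext q
    simp only [S, Set.mem_preimage, Set.mem_univ_pi, Fin.forall_fin_two, Function.comp]
    rfl
  rw [hpre, hmp.measure_preimage hS.nullMeasurableSet, volume_pi, Measure.pi_pi,
    Fin.prod_univ_two]
  simp

/-- The part of a ball in a strip of width `2 * h`. -/
lemma volume_strip_le (α c h R : ℝ) (hR : 0 ≤ R) :
    volume {q : Plane | ‖q‖ ≤ R ∧ |perp α q - c| ≤ h} ≤ ENNReal.ofReal (4 * R * h) := by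
  calc _ ≤ volume {q : Plane | along α q ∈ Set.Icc (-R) R ∧ perp α q ∈ Set.Icc (c - h) (c + h)} := by
        apply measure_mono
        rintro q ⟨h1, h2⟩
        have := abs_le.1 ((abs_along_le α q).trans h1)
        have h3 := abs_le.1 h2
        exact ⟨this, by constructor <;> linarith [h3.1, h3.2]⟩
    _ = ENNReal.ofReal (4 * R * h) := by
        rw [volume_frame_rect, ← ENNReal.ofReal_mul (by linarith)]
        congr 1; ring

/-! ### Geometry of sectors -/

lemma sector_eq_image (x : Plane) (α β : ℝ) :
    sector x α β = (fun y : ℝ × ℝ => x + y.1 • dir y.2) '' (Set.Ici 0 ×ˢ Set.Icc α β) := by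
  ext q
  constructor
  · rintro ⟨κ, hκ, θ, hθ, rfl⟩
    exact ⟨(κ, θ), ⟨hκ, hθ⟩, rfl⟩
  · rintro ⟨⟨κ, θ⟩, ⟨hκ, hθ⟩, rfl⟩
    exact ⟨κ, hκ, θ, hθ, rfl⟩

lemma continuous_dir : Continuous dir := by
  unfold dir
  refine (PiLp.continuous_toLp 2 _).comp (continuous_pi fun i => ?_)
  fin_cases i
  · exact Real.continuous_cos
  · exact Real.continuous_sin

/-- Truncating the radius at n ∈ ℕ exhibits the sector as a countable union of compact images. -/
lemma measurableSet_sector (x : Plane) (α β : ℝ) : MeasurableSet (sector x α β) := by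
  have h : sector x α β = ⋃ n : ℕ, (fun y : ℝ × ℝ => x + y.1 • dir y.2) ''
      (Set.Icc 0 (n : ℝ) ×ˢ Set.Icc α β) := by
    rw [sector_eq_image, ← Set.image_iUnion]
    congr 1
    ext ⟨κ, θ⟩
    simp only [Set.mem_prod, Set.mem_Ici, Set.mem_iUnion, Set.mem_Icc]
    constructor
    · rintro ⟨h1, h2⟩
      obtain ⟨n, hn⟩ := exists_nat_ge κ
      exact ⟨n, ⟨h1, hn⟩, h2⟩
    · rintro ⟨n, h1, h2⟩
      exact ⟨h1.1, h2⟩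
  rw [h]
  refine MeasurableSet.iUnion fun n => ((isCompact_Icc.prod isCompact_Icc).image ?_).measurableSet
  have := continuous_dir
  fun_prop

lemma sector_mono {x : Plane} {α β α' β' : ℝ} (hα : α' ≤ α) (hβ : β ≤ β') :
    sector x α β ⊆ sector x α' β' := by
  rintro q ⟨κ, hκ, θ, hθ, rfl⟩
  exact ⟨κ, hκ, θ, ⟨hα.trans hθ.1, hθ.2.trans hβ⟩, rfl⟩

lemma mem_sector_iff {x q : Plane} {α β : ℝ} :
    q ∈ sector x α β ↔ ∃ κ : ℝ, 0 ≤ κ ∧ ∃ θ ∈ Set.Icc α β, q - x = κ • dir θ := by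
  simp only [sector, Set.mem_ofPred_eq, sub_eq_iff_eq_add']

/-- A sector is contained in a strip along its initial ray whose width is proportional to the
opening angle. -/
lemma abs_perp_le_of_mem_sector {x q : Plane} {α β : ℝ} (hq : q ∈ sector x α β) :
    |perp α (q - x)| ≤ ‖q - x‖ * (β - α) := by
  obtain ⟨κ, hκ, θ, hθ, h⟩ := mem_sector_iff.1 hq
  rw [h, perp_smul_dir, norm_smul_dir hκ, abs_mul, abs_of_nonneg hκ]
  refine mul_le_mul_of_nonneg_left ?_ hκ
  refine Real.abs_sin_le_abs.trans ?_
  rw [abs_of_nonneg (by linarith [hθ.1])]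
  linarith [hθ.2]

lemma sector_diff_subset_of_angles (x : Plane) (α β α' β' : ℝ) :
    sector x α β \ sector x α' β' ⊆ sector x α α' ∪ sector x β' β := by
  rintro q ⟨⟨κ, hκ, θ, hθ, rfl⟩, hn⟩
  by_cases h1 : θ < α'
  · exact Or.inl ⟨κ, hκ, θ, ⟨hθ.1, h1.le⟩, rfl⟩
  · by_cases h2 : β' < θ
    · exact Or.inr ⟨κ, hκ, θ, ⟨h2.le, hθ.2⟩, rfl⟩
    · exact absurd ⟨κ, hκ, θ, ⟨not_lt.1 h1, not_lt.1 h2⟩, rfl⟩ hn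

lemma sin_pos_iff_of_mem {y : ℝ} (h0 : 0 ≤ y) (h1 : y < 2 * Real.pi) :
    0 < Real.sin y ↔ 0 < y ∧ y < Real.pi := by
  constructor
  · intro h
    constructor
    · rcases h0.eq_or_lt with rfl | h0
      · simp at h
      · exact h0
    · by_contra hc
      have := Real.sin_nonneg_of_nonneg_of_le_pi (x := y - Real.pi) (by linarith) (by linarith)
      rw [Real.sin_sub_pi] at this
      linarith
  · rintro ⟨h2, h3⟩
    exact Real.sin_pos_of_pos_of_lt_pi h2 h3

/-- Away from the two lines that bound a sector, membership depends only on the sides of these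
lines on which a point lies. -/
lemma mem_Icc_of_sin_mul_pos {α β θ θ' : ℝ} (hθ : θ ∈ Set.Icc α β)
    (hθ' : θ' ∈ Set.Ico α (α + 2 * Real.pi))
    (h1 : 0 < Real.sin (θ - α) * Real.sin (θ' - α))
    (h2 : 0 < Real.sin (θ - β) * Real.sin (θ' - β)) : θ' ∈ Set.Icc α β := by
  refine ⟨hθ'.1, ?_⟩
  by_contra! hlt
  have a1 := hθ.1
  have a2 := hθ.2
  have a3 := hθ'.1
  have a4 := hθ'.2
  have hb : Real.sin (θ - β) = - Real.sin (β - θ) := by rw [← Real.sin_neg]; congr 1; ring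
  rw [hb] at h2
  -- In either case θ ≤ β < θ' lie in one half-turn bounded by the line at α, so the line at β
  -- cannot have θ and θ' strictly on the same side.
  rcases lt_or_ge 0 (Real.sin (θ - α)) with hs | hs
  · have hs' : 0 < Real.sin (θ' - α) := (pos_iff_pos_of_mul_pos h1).1 hs
    rw [sin_pos_iff_of_mem (by linarith) (by linarith)] at hs hs'
    have h3 : 0 < Real.sin (θ' - β) :=
      Real.sin_pos_of_pos_of_lt_pi (by linarith) (by linarith [hs'.2])
    have h4 := Real.sin_nonneg_of_nonneg_of_le_pi (x := β - θ) (by linarith) (by linarith [hs'.2])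
    nlinarith
  · have hc : Real.pi ≤ θ - α := by
      by_contra! hc
      have h5 := Real.sin_nonneg_of_nonneg_of_le_pi (x := θ - α) (by linarith) hc.le
      have : Real.sin (θ - α) = 0 := le_antisymm hs h5
      rw [this] at h1; simp at h1
    have h3 : 0 < Real.sin (θ' - β) :=
      Real.sin_pos_of_pos_of_lt_pi (by linarith) (by linarith)
    have h4 := Real.sin_nonneg_of_nonneg_of_le_pi (x := β - θ) (by linarith) (by linarith)
    nlinarith

lemma mul_pos_of_abs_sub_lt {a b h : ℝ} (hab : |a - b| ≤ h) (ha : h < |a|) : 0 < a * b := by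
  have h1 := abs_le.1 hab
  rcases le_or_gt 0 a with h0 | h0
  · rw [abs_of_nonneg h0] at ha
    have : 0 < b := by linarith
    have : 0 < a := by linarith [abs_nonneg (a - b)]
    positivity
  · rw [abs_of_neg h0] at ha
    exact mul_pos_of_neg_of_neg h0 (by linarith)

/-- Moving the apex changes each `perp` coordinate by at most ‖x - x'‖. Outside the two strips a
point thus stays on the same side of both boundary lines, and `mem_Icc_of_sin_mul_pos` applies. -/
lemma sector_diff_subset_of_apex (x x' : Plane) (α β : ℝ) :
    sector x α β \ sector x' α β ⊆
      {q | |perp α (q - x)| ≤ ‖x - x'‖} ∪ {q | |perp β (q - x)| ≤ ‖x - x'‖} := by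
  rintro q ⟨hq, hn⟩
  by_contra hc
  simp only [Set.mem_union, Set.mem_ofPred_eq, not_or, not_le] at hc
  have key : ∀ γ, |perp γ (q - x) - perp γ (q - x')| ≤ ‖x - x'‖ := fun γ => by
    rw [← perp_sub]
    refine (abs_perp_le _ _).trans_eq ?_
    rw [← norm_neg]; congr 1; abel
  have hα := mul_pos_of_abs_sub_lt (key α) hc.1
  have hβ := mul_pos_of_abs_sub_lt (key β) hc.2
  obtain ⟨κ, hκ, θ, hθ, h⟩ := mem_sector_iff.1 hq
  obtain ⟨κ', hκ', θ', hθ', h'⟩ := exists_eq_smul_dir α (q - x')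
  apply hn
  rw [h, h', perp_smul_dir, perp_smul_dir, mul_mul_mul_comm] at hα hβ
  have hκκ : 0 ≤ κ * κ' := mul_nonneg hκ hκ'
  exact mem_sector_iff.2 ⟨κ', hκ', θ', mem_Icc_of_sin_mul_pos hθ hθ'
    (pos_of_mul_pos_right hα hκκ) (pos_of_mul_pos_right hβ hκκ), h'⟩

/-- A common point other than the apex has angles θ ≤ β ≤ θ' that differ by 0 or by 2π. The first
forces θ = β, the second θ = α. The strips of width zero are null sets. -/
lemma sector_inter_subset {x : Plane} {α β γ : ℝ}
    (hαγ : γ ≤ α + 2 * Real.pi) :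
    sector x α β ∩ sector x β γ ⊆ {q | |perp α (q - x)| ≤ 0} ∪ {q | |perp β (q - x)| ≤ 0} := by
  rintro q ⟨hq, hq'⟩
  obtain ⟨κ, hκ, θ, hθ, h⟩ := mem_sector_iff.1 hq
  obtain ⟨κ', hκ', θ', hθ', h'⟩ := mem_sector_iff.1 hq'
  have hkk : κ = κ' := by rw [← norm_smul_dir hκ θ, ← norm_smul_dir hκ' θ', ← h, ← h']
  subst hkk
  rcases hκ.eq_or_lt with rfl | hκ0
  · left; rw [Set.mem_ofPred_eq, h, perp_smul_dir]; simp
  have hd : dir θ = dir θ' := smul_right_injective _ hκ0.ne' (h.symm.trans h')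
  have hc : Real.cos (θ' - θ) = 1 := by
    have e0 : Real.cos θ = Real.cos θ' := by simpa [dir_zero_coord] using congrArg (fun v : Plane => v 0) hd
    have e1 : Real.sin θ = Real.sin θ' := by simpa [dir_one_coord] using congrArg (fun v : Plane => v 1) hd
    rw [Real.cos_sub, e0, e1, ← sq, ← sq, Real.cos_sq_add_sin_sq]
  have hle : θ' - θ ≤ 2 * Real.pi := by linarith [hθ.1, hθ'.2]
  rcases hle.eq_or_lt with he | hl
  · left
    have : θ = α := by linarith [hθ.1, hθ'.2]
    rw [Set.mem_ofPred_eq, h, this]; simp [perp_smul_dir]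
  · right
    have h0 := (Real.cos_eq_one_iff_of_lt_of_lt (by linarith [hθ.2, hθ'.1, Real.pi_pos]) hl).1 hc
    have : θ = β := by linarith [hθ.2, hθ'.1]
    rw [Set.mem_ofPred_eq, h, this]; simp [perp_smul_dir]

/-- A sector contains a rectangle near its apex. -/
lemma rect_subset_sector_inter_ball {x : Plane} {α s δ : ℝ} (hδ : 0 < δ) (hs : s ≤ 1) :
    {q : Plane | along α q ∈ Set.Icc (along α x + δ / 4) (along α x + δ / 2) ∧
      perp α q ∈ Set.Icc (perp α x + 0) (perp α x + δ / 4 * s)} ⊆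
      sector x α (α + s) ∩ Metric.ball x δ := by
  rintro q ⟨⟨h1, h2⟩, h3, h4⟩
  have ha := along_sub α q x
  have hp := perp_sub α q x
  set a := along α (q - x) with hadef
  set b := perp α (q - x) with hbdef
  have ha1 : δ / 4 ≤ a := by linarith
  have ha2 : a ≤ δ / 2 := by linarith
  have hb1 : 0 ≤ b := by linarith
  have hb2 : b ≤ δ / 4 * s := by linarith
  have ha0 : 0 < a := by linarith
  have hs0 : 0 ≤ s := by nlinarith
  have hnorm := along_sq_add_perp_sq α (q - x)
  rw [← hadef, ← hbdef] at hnorm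
  constructor
  -- With θ taken in [α - π, α + π), a positive cosine and a nonnegative sine of θ - α leave only 0
  -- ≤ θ - α < π / 2. Then θ - α ≤ tan (θ - α) = b / a ≤ s.
  · obtain ⟨κ, hκ, θ, hθ, h⟩ := exists_eq_smul_dir (α - Real.pi) (q - x)
    refine mem_sector_iff.2 ⟨κ, hκ, θ, ?_, h⟩
    have hb : b = κ * Real.sin (θ - α) := by rw [hbdef, h, perp_smul_dir]
    have haκ : a = κ * Real.cos (θ - α) := by
      rw [hadef, h]
      simp only [along, PiLp.smul_apply, dir_zero_coord, dir_one_coord, Real.cos_sub, smul_eq_mul]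
      ring
    have hκ0 : 0 < κ := by
      rcases hκ.eq_or_lt with rfl | h0
      · simp at haκ; linarith
      · exact h0
    have hcos : 0 < Real.cos (θ - α) := by
      rw [haκ] at ha0; exact pos_of_mul_pos_right ha0 hκ
    have hsin : 0 ≤ Real.sin (θ - α) := by
      rw [hb] at hb1; exact nonneg_of_mul_nonneg_right hb1 hκ0
    have hl1 : α ≤ θ := by
      by_contra! hlt
      have h5 := hθ.1
      rcases h5.eq_or_lt with h6 | h6
      · rw [← h6, show α - Real.pi - α = -Real.pi by ring, Real.cos_neg, Real.cos_pi] at hcos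
        linarith
      · have := Real.sin_neg_of_neg_of_neg_pi_lt (x := θ - α) (by linarith) (by linarith)
        linarith
    have hl2 : θ - α < Real.pi / 2 := by
      by_contra! hge
      have := Real.cos_nonpos_of_pi_div_two_le_of_le hge (by linarith [hθ.2, Real.pi_pos])
      linarith
    refine ⟨hl1, ?_⟩
    by_contra! hgt
    have h7 : Real.tan (θ - α) = b / a := by
      rw [hb, haκ, Real.tan_eq_sin_div_cos, mul_div_mul_left _ _ hκ0.ne']
    have h8 : θ - α ≤ Real.tan (θ - α) := Real.le_tan (by linarith) hl2
    have h9 : b / a ≤ s := by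
      rw [div_le_iff₀ ha0]; nlinarith
    linarith
  · rw [Metric.mem_ball, dist_eq_norm]
    apply lt_of_pow_lt_pow_left₀ 2 hδ.le
    rw [← hnorm]
    have : b ≤ δ / 4 := by nlinarith
    nlinarith

/-- Only the first eighth of the opening is used: as 2π < 8, its angle is at most 1, as the
rectangle lemma requires. The rectangle has sides δ / 4 and (δ / 4) * (β - α) / 8, which gives the
constant 128. -/
lemma volume_sector_inter_ball_ge {x : Plane} {α β δ : ℝ} (hδ : 0 < δ) (h0 : α ≤ β)
    (h1 : β ≤ α + 2 * Real.pi) :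
    ENNReal.ofReal (δ ^ 2 / 128 * (β - α)) ≤ volume (sector x α β ∩ Metric.ball x δ) := by
  have hpi := Real.pi_lt_four
  calc ENNReal.ofReal (δ ^ 2 / 128 * (β - α))
      = ENNReal.ofReal (along α x + δ / 2 - (along α x + δ / 4)) * ENNReal.ofReal
        (perp α x + δ / 4 * ((β - α) / 8) - (perp α x + 0)) := by
        rw [← ENNReal.ofReal_mul (by linarith)]; congr 1; ring
    _ ≤ volume (sector x α (α + (β - α) / 8) ∩ Metric.ball x δ) := by
        rw [← volume_frame_rect]
        exact measure_mono (rect_subset_sector_inter_ball hδ (by linarith))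
    _ ≤ _ := measure_mono (Set.inter_subset_inter_left _ (sector_mono le_rfl (by linarith)))

/-! ### Lipschitz dependence of sector integrals on apex and angles -/

/-- The integrals over A ∩ B cancel, so only the symmetric difference contributes. -/
lemma norm_setIntegral_sub_le {E : Type*} [NormedAddCommGroup E] [NormedSpace ℝ E]
    {g : Plane → E} {A B D : Set Plane} {M : ℝ} (hA : MeasurableSet A) (hB : MeasurableSet B)
    (hAD : A ⊆ D) (hBD : B ⊆ D) (hD : volume D < ⊤) (hg : IntegrableOn g D)
    (hM : ∀ q ∈ D, ‖g q‖ ≤ M) :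
    ‖(∫ q in A, g q) - ∫ q in B, g q‖ ≤ M * (volume.real (A \ B) + volume.real (B \ A)) := by
  have h1 := integral_inter_add_sdiff hB (hg.mono_set hAD)
  have h2 := integral_inter_add_sdiff hA (hg.mono_set hBD)
  rw [Set.inter_comm] at h2
  have key : ∀ S ⊆ D, ‖∫ q in S, g q‖ ≤ M * volume.real S := fun S hS =>
    norm_setIntegral_le_of_norm_le_const ((measure_mono hS).trans_lt hD) fun q hq => hM q (hS hq)
  calc _ = ‖(∫ q in A \ B, g q) - ∫ q in B \ A, g q‖ := by
        rw [← h1, ← h2, add_sub_add_left_eq_sub]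
    _ ≤ _ := by
        rw [mul_add]
        exact (norm_sub_le _ _).trans (add_le_add (key _ (Set.sdiff_subset.trans hAD))
          (key _ (Set.sdiff_subset.trans hBD)))

lemma measureReal_strip_le {Ω : Set Plane} {R : ℝ} (hR : ∀ q ∈ Ω, ‖q‖ ≤ R) (hR0 : 0 ≤ R)
    (x : Plane) (α : ℝ) {h : ℝ} (hh : 0 ≤ h) :
    volume.real (Ω ∩ {q | |perp α (q - x)| ≤ h}) ≤ 4 * R * h := by
  refine ENNReal.toReal_le_of_le_ofReal (by positivity) ((measure_mono ?_).trans
    (volume_strip_le α (perp α x) h R hR0))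
  rintro q ⟨hq, h1⟩
  rw [Set.mem_ofPred_eq, perp_sub] at h1
  exact ⟨hR q hq, h1⟩

lemma volume_lt_top_of_norm_le {Ω : Set Plane} {R : ℝ} (hR : ∀ q ∈ Ω, ‖q‖ ≤ R) :
    volume Ω < ⊤ :=
  (measure_mono fun q hq => mem_closedBall_zero_iff.2 (hR q hq)).trans_lt
    (measure_closedBall_lt_top (x := (0 : Plane)) (r := R))

lemma measureReal_sector_diff_apex_le {Ω : Set Plane} {R : ℝ} (hR : ∀ q ∈ Ω, ‖q‖ ≤ R)
    (hR0 : 0 ≤ R) (x x' : Plane) (α β : ℝ) :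
    volume.real ((Ω ∩ sector x α β) \ (Ω ∩ sector x' α β)) ≤ 8 * R * ‖x - x'‖ := by
  have hfin := volume_lt_top_of_norm_le hR
  calc _ ≤ volume.real ((Ω ∩ {q | |perp α (q - x)| ≤ ‖x - x'‖}) ∪
        (Ω ∩ {q | |perp β (q - x)| ≤ ‖x - x'‖})) := by
        refine measureReal_mono ?_ ((measure_mono ?_).trans_lt hfin).ne
        · rintro q ⟨⟨hq, h1⟩, h2⟩
          rcases sector_diff_subset_of_apex x x' α β ⟨h1, fun h => h2 ⟨hq, h⟩⟩ with h | h
          · exact Or.inl ⟨hq, h⟩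
          · exact Or.inr ⟨hq, h⟩
        · rintro q (h | h)
          · exact h.1
          · exact h.1
    _ ≤ 4 * R * ‖x - x'‖ + 4 * R * ‖x - x'‖ :=
        (measureReal_union_le _ _).trans (add_le_add
          (measureReal_strip_le hR hR0 _ _ (norm_nonneg _))
          (measureReal_strip_le hR hR0 _ _ (norm_nonneg _)))
    _ = _ := by ring

lemma measureReal_sector_le {Ω : Set Plane} {R : ℝ} (hR : ∀ q ∈ Ω, ‖q‖ ≤ R)
    {x : Plane} (hx : ‖x‖ ≤ R) (α β : ℝ) :
    volume.real (Ω ∩ sector x α β) ≤ 8 * R ^ 2 * |β - α| := by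
  have hR0 : 0 ≤ R := (norm_nonneg x).trans hx
  have hfin := volume_lt_top_of_norm_le hR
  calc _ ≤ volume.real (Ω ∩ {q | |perp α (q - x)| ≤ 2 * R * |β - α|}) := by
        refine measureReal_mono ?_ ((measure_mono Set.inter_subset_left).trans_lt hfin).ne
        rintro q ⟨hq, h⟩
        refine ⟨hq, (abs_perp_le_of_mem_sector h).trans ?_⟩
        have : ‖q - x‖ ≤ 2 * R := (norm_sub_le _ _).trans (by linarith [hR q hq])
        exact mul_le_mul this (le_abs_self _) (by
          obtain ⟨κ, -, θ, hθ, -⟩ := h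
          linarith [hθ.1, hθ.2]) (by positivity)
    _ ≤ 4 * R * (2 * R * |β - α|) := measureReal_strip_le hR hR0 _ _ (by positivity)
    _ = _ := by ring

lemma measureReal_sector_diff_angles_le {Ω : Set Plane} {R : ℝ} (hR : ∀ q ∈ Ω, ‖q‖ ≤ R)
    {x : Plane} (hx : ‖x‖ ≤ R) (α β α' β' : ℝ) :
    volume.real ((Ω ∩ sector x α β) \ (Ω ∩ sector x α' β'))
      ≤ 8 * R ^ 2 * (|α - α'| + |β - β'|) := by
  have hfin := volume_lt_top_of_norm_le hR
  calc _ ≤ volume.real ((Ω ∩ sector x α α') ∪ (Ω ∩ sector x β' β)) := by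
        refine measureReal_mono ?_ ((measure_mono ?_).trans_lt hfin).ne
        · rintro q ⟨⟨hq, h1⟩, h2⟩
          rcases sector_diff_subset_of_angles x α β α' β' ⟨h1, fun h => h2 ⟨hq, h⟩⟩ with h | h
          · exact Or.inl ⟨hq, h⟩
          · exact Or.inr ⟨hq, h⟩
        · rintro q (h | h)
          · exact h.1
          · exact h.1
    _ ≤ 8 * R ^ 2 * |α' - α| + 8 * R ^ 2 * |β - β'| :=
        (measureReal_union_le _ _).trans (add_le_add
          (measureReal_sector_le hR hx _ _) (measureReal_sector_le hR hx _ _))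
    _ = _ := by rw [abs_sub_comm α']; ring

/-- The integral over a sector depends on its apex in a Lipschitz way. -/
lemma norm_integral_sector_sub_apex_le {E : Type*} [NormedAddCommGroup E] [NormedSpace ℝ E]
    {Ω : Set Plane} {R M : ℝ} (hΩ : MeasurableSet Ω) (hR : ∀ q ∈ Ω, ‖q‖ ≤ R) (hR0 : 0 ≤ R)
    (hM0 : 0 ≤ M) {g : Plane → E} (hg : IntegrableOn g Ω) (hM : ∀ q ∈ Ω, ‖g q‖ ≤ M)
    (x x' : Plane) (α β : ℝ) :
    ‖(∫ q in Ω ∩ sector x α β, g q) - ∫ q in Ω ∩ sector x' α β, g q‖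
      ≤ 16 * R * M * ‖x - x'‖ := by
  refine (norm_setIntegral_sub_le (hΩ.inter (measurableSet_sector _ _ _))
    (hΩ.inter (measurableSet_sector _ _ _)) Set.inter_subset_left Set.inter_subset_left
    (volume_lt_top_of_norm_le hR) hg hM).trans ?_
  have h1 := measureReal_sector_diff_apex_le hR hR0 x x' α β
  have h2 := measureReal_sector_diff_apex_le hR hR0 x' x α β
  rw [norm_sub_rev] at h2
  nlinarith

/-- The integral over a sector depends on its phase angles in a Lipschitz way. -/
lemma norm_integral_sector_sub_angles_le {E : Type*} [NormedAddCommGroup E] [NormedSpace ℝ E]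
    {Ω : Set Plane} {R M : ℝ} (hΩ : MeasurableSet Ω) (hR : ∀ q ∈ Ω, ‖q‖ ≤ R)
    (hM0 : 0 ≤ M) {g : Plane → E} (hg : IntegrableOn g Ω) (hM : ∀ q ∈ Ω, ‖g q‖ ≤ M)
    {x : Plane} (hx : ‖x‖ ≤ R) (α β α' β' : ℝ) :
    ‖(∫ q in Ω ∩ sector x α β, g q) - ∫ q in Ω ∩ sector x α' β', g q‖
      ≤ 16 * R ^ 2 * M * (|α - α'| + |β - β'|) := by
  refine (norm_setIntegral_sub_le (hΩ.inter (measurableSet_sector _ _ _))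
    (hΩ.inter (measurableSet_sector _ _ _)) Set.inter_subset_left Set.inter_subset_left
    (volume_lt_top_of_norm_le hR) hg hM).trans ?_
  have h1 := measureReal_sector_diff_angles_le hR hx α β α' β'
  have h2 := measureReal_sector_diff_angles_le hR hx α' β' α β
  rw [abs_sub_comm α', abs_sub_comm β'] at h2
  nlinarith

lemma tendsto_integral_sector {E ι : Type*} [NormedAddCommGroup E] [NormedSpace ℝ E]
    {Ω : Set Plane} {R M : ℝ} (hΩ : MeasurableSet Ω) (hR : ∀ q ∈ Ω, ‖q‖ ≤ R)
    (hM0 : 0 ≤ M) {g : Plane → E} (hg : IntegrableOn g Ω) (hM : ∀ q ∈ Ω, ‖g q‖ ≤ M)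
    {l : Filter ι} {x : ι → Plane} {α β : ι → ℝ} {x₀ : Plane} {α₀ β₀ : ℝ} (hx₀ : ‖x₀‖ ≤ R)
    (hx : Tendsto x l (𝓝 x₀)) (hα : Tendsto α l (𝓝 α₀)) (hβ : Tendsto β l (𝓝 β₀)) :
    Tendsto (fun t => ∫ q in Ω ∩ sector (x t) (α t) (β t), g q) l
      (𝓝 (∫ q in Ω ∩ sector x₀ α₀ β₀, g q)) := by
  have hR0 : 0 ≤ R := (norm_nonneg x₀).trans hx₀
  rw [tendsto_iff_norm_sub_tendsto_zero]
  have hb : Tendsto (fun t => 16 * R * M * ‖x t - x₀‖ +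
      16 * R ^ 2 * M * (|α t - α₀| + |β t - β₀|)) l (𝓝 0) := by
    have h1 := tendsto_iff_norm_sub_tendsto_zero.1 hx
    have h2 := tendsto_iff_norm_sub_tendsto_zero.1 hα
    have h3 := tendsto_iff_norm_sub_tendsto_zero.1 hβ
    simpa using (h1.const_mul (16 * R * M)).add ((h2.add h3).const_mul (16 * R ^ 2 * M))
  refine squeeze_zero (fun t => norm_nonneg _) (fun t => ?_) hb
  refine (norm_sub_le_norm_sub_add_norm_sub _ (∫ q in Ω ∩ sector x₀ (α t) (β t), g q) _).trans ?_
  exact add_le_add (norm_integral_sector_sub_apex_le hΩ hR hR0 hM0 hg hM _ _ _ _)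
    (norm_integral_sector_sub_angles_le hΩ hR hM0 hg hM hx₀ _ _ _ _)

/-! ### Mass and centroid of sectors for a bounded density -/

/-- A measurable region in the ball of radius `R` with a density between positive bounds. -/
structure IsRegion (Ω : Set Plane) (ρ : Plane → ℝ) (ρlo ρhi R : ℝ) : Prop where
  meas : MeasurableSet Ω
  dens : AEMeasurable ρ (volume.restrict Ω)
  norm_le : ∀ q ∈ Ω, ‖q‖ ≤ R
  lo_pos : 0 < ρlo
  lo_le : ∀ q ∈ Ω, ρlo ≤ ρ q
  le_hi : ∀ q ∈ Ω, ρ q ≤ ρhi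
  lo_le_hi : ρlo ≤ ρhi

namespace IsRegion

variable {Ω : Set Plane} {ρ : Plane → ℝ} {ρlo ρhi R : ℝ}

lemma hi_pos (h : IsRegion Ω ρ ρlo ρhi R) : 0 < ρhi := h.lo_pos.trans_le h.lo_le_hi

lemma norm_dens_le (h : IsRegion Ω ρ ρlo ρhi R) : ∀ q ∈ Ω, ‖ρ q‖ ≤ ρhi := fun q hq => by
  rw [Real.norm_of_nonneg (h.lo_pos.le.trans (h.lo_le q hq))]
  exact h.le_hi q hq

lemma volume_lt_top (h : IsRegion Ω ρ ρlo ρhi R) : volume Ω < ⊤ :=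
  volume_lt_top_of_norm_le h.norm_le

lemma integrableOn_of_norm_le {E : Type*} [NormedAddCommGroup E] (h : IsRegion Ω ρ ρlo ρhi R)
    {g : Plane → E} {M : ℝ} (hg : AEStronglyMeasurable g (volume.restrict Ω))
    (hM : ∀ q ∈ Ω, ‖g q‖ ≤ M) : IntegrableOn g Ω :=
  IntegrableOn.of_bound h.volume_lt_top hg M ((ae_restrict_iff' h.meas).2 (ae_of_all _ hM))

lemma integrableOn_dens (h : IsRegion Ω ρ ρlo ρhi R) : IntegrableOn ρ Ω :=
  h.integrableOn_of_norm_le h.dens.aestronglyMeasurable h.norm_dens_le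

lemma norm_moment_le (h : IsRegion Ω ρ ρlo ρhi R) : ∀ q ∈ Ω, ‖ρ q • q‖ ≤ ρhi * R :=
  fun q hq => by
    rw [norm_smul]
    exact mul_le_mul (h.norm_dens_le q hq) (h.norm_le q hq) (norm_nonneg _) h.hi_pos.le

lemma integrableOn_moment (h : IsRegion Ω ρ ρlo ρhi R) : IntegrableOn (fun q => ρ q • q) Ω :=
  h.integrableOn_of_norm_le (h.dens.aestronglyMeasurable.smul
    measurable_id.aestronglyMeasurable) h.norm_moment_le

lemma integrableOn_normSq (h : IsRegion Ω ρ ρlo ρhi R) :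
    IntegrableOn (fun q => ‖q‖ ^ 2 * ρ q) Ω := by
  refine h.integrableOn_of_norm_le (M := R ^ 2 * ρhi) ?_ fun q hq => ?_
  · exact (measurable_norm.pow_const 2).aestronglyMeasurable.mul h.dens.aestronglyMeasurable
  · rw [norm_mul]
    refine mul_le_mul ?_ (h.norm_dens_le q hq) (norm_nonneg _) (by positivity)
    rw [norm_pow, norm_norm]
    exact pow_le_pow_left₀ (norm_nonneg _) (h.norm_le q hq) 2

lemma mass_mono (h : IsRegion Ω ρ ρlo ρhi R) {A B : Set Plane} (hAB : A ⊆ B) (hB : B ⊆ Ω)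
    (hBm : MeasurableSet B) : mass ρ A ≤ mass ρ B := by
  refine setIntegral_mono_set (h.integrableOn_dens.mono_set hB) ?_ hAB.eventuallyLE
  exact (ae_restrict_iff' hBm).2 (ae_of_all _ fun q hq => h.lo_pos.le.trans (h.lo_le q (hB hq)))

lemma lo_mul_le_mass (h : IsRegion Ω ρ ρlo ρhi R) {A : Set Plane} (hA : A ⊆ Ω)
    (hAm : MeasurableSet A) : ρlo * volume.real A ≤ mass ρ A := by
  have hfin : volume A ≠ ⊤ := ((measure_mono hA).trans_lt h.volume_lt_top).ne
  have := setIntegral_mono_on (integrableOn_const hfin) (h.integrableOn_dens.mono_set hA) hAm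
    (fun q hq => h.lo_le q (hA hq))
  rwa [setIntegral_const, smul_eq_mul, mul_comm] at this

/-- The mass of a sector whose apex is well inside the region grows at least linearly with the
opening angle. -/
lemma le_mass_sector (h : IsRegion Ω ρ ρlo ρhi R) {x : Plane} {δ : ℝ} (hδ : 0 < δ)
    (hx : Metric.ball x δ ⊆ Ω) {α β : ℝ} (h0 : α ≤ β) (h1 : β ≤ α + 2 * Real.pi) :
    ρlo * (δ ^ 2 / 128) * (β - α) ≤ mass ρ (Ω ∩ sector x α β) := by
  have hm := h.meas.inter (measurableSet_sector x α β)
  refine le_trans ?_ (h.lo_mul_le_mass Set.inter_subset_left hm)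
  rw [mul_assoc]
  refine mul_le_mul_of_nonneg_left ?_ h.lo_pos.le
  refine (ENNReal.ofReal_le_iff_le_toReal
    ((measure_mono Set.inter_subset_left).trans_lt h.volume_lt_top).ne).1 ?_
  exact (volume_sector_inter_ball_ge (x := x) hδ h0 h1).trans
    (measure_mono fun q hq => ⟨hx hq.2, hq.1⟩)

/-- The bound by a full turn makes the overlap of adjacent sectors null. Superadditivity is all that
the lower bounds on the workload derivatives need. -/
lemma mass_sector_add_le (h : IsRegion Ω ρ ρlo ρhi R) (hR0 : 0 ≤ R) {x : Plane} {α β γ : ℝ}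
    (hαβ : α ≤ β) (hβγ : β ≤ γ) (hαγ : γ ≤ α + 2 * Real.pi) :
    mass ρ (Ω ∩ sector x α β) + mass ρ (Ω ∩ sector x β γ) ≤ mass ρ (Ω ∩ sector x α γ) := by
  have hnull : ∀ η, volume (Ω ∩ {q | |perp η (q - x)| ≤ 0}) = 0 := fun η => by
    have h1 := measureReal_strip_le h.norm_le hR0 x η le_rfl
    rw [mul_zero] at h1
    exact (measureReal_eq_zero_iff ((measure_mono Set.inter_subset_left).trans_lt
      h.volume_lt_top).ne).1 (le_antisymm h1 measureReal_nonneg)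
  have hd : AEDisjoint volume (Ω ∩ sector x α β) (Ω ∩ sector x β γ) := by
    refine measure_mono_null ?_ (measure_union_null (hnull α) (hnull β))
    rintro q ⟨⟨hq, h1⟩, -, h2⟩
    rcases sector_inter_subset hαγ ⟨h1, h2⟩ with h3 | h3
    · exact Or.inl ⟨hq, h3⟩
    · exact Or.inr ⟨hq, h3⟩
  have hm := fun α β => h.meas.inter (measurableSet_sector x α β)
  have hi := fun α β => h.integrableOn_dens.mono_set
    (Set.inter_subset_left : Ω ∩ sector x α β ⊆ Ω)
  rw [mass, mass, ← setIntegral_union₀ hd (hm β γ).nullMeasurableSet (hi α β) (hi β γ)]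
  refine h.mass_mono ?_ Set.inter_subset_left (hm α γ)
  rintro q (hq | hq)
  · exact ⟨hq.1, sector_mono le_rfl hβγ hq.2⟩
  · exact ⟨hq.1, sector_mono hαβ le_rfl hq.2⟩

lemma tendsto_mass_sector {ι : Type*} (h : IsRegion Ω ρ ρlo ρhi R)
    {l : Filter ι} {x : ι → Plane} {α β : ι → ℝ} {x₀ : Plane} {α₀ β₀ : ℝ} (hx₀ : ‖x₀‖ ≤ R)
    (hx : Tendsto x l (𝓝 x₀)) (hα : Tendsto α l (𝓝 α₀)) (hβ : Tendsto β l (𝓝 β₀)) :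
    Tendsto (fun t => mass ρ (Ω ∩ sector (x t) (α t) (β t))) l
      (𝓝 (mass ρ (Ω ∩ sector x₀ α₀ β₀))) :=
  tendsto_integral_sector h.meas h.norm_le h.hi_pos.le h.integrableOn_dens h.norm_dens_le hx₀
    hx hα hβ

lemma tendsto_centroid_sector {ι : Type*} (h : IsRegion Ω ρ ρlo ρhi R)
    {l : Filter ι} {x : ι → Plane} {α β : ι → ℝ} {x₀ : Plane} {α₀ β₀ : ℝ} (hx₀ : ‖x₀‖ ≤ R)
    (hpos : 0 < mass ρ (Ω ∩ sector x₀ α₀ β₀))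
    (hx : Tendsto x l (𝓝 x₀)) (hα : Tendsto α l (𝓝 α₀)) (hβ : Tendsto β l (𝓝 β₀)) :
    Tendsto (fun t => centroid ρ (Ω ∩ sector (x t) (α t) (β t))) l
      (𝓝 (centroid ρ (Ω ∩ sector x₀ α₀ β₀))) :=
  ((h.tendsto_mass_sector hx₀ hx hα hβ).inv₀ hpos.ne').smul
    (tendsto_integral_sector h.meas h.norm_le
      (mul_nonneg h.hi_pos.le ((norm_nonneg _).trans hx₀)) h.integrableOn_moment
      h.norm_moment_le hx₀ hx hα hβ)

/-! ### The quadratic cost -/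

/-- The parallel axis identity: expand the square and complete it at the centroid. -/
lemma localCost_quadCost_eq (h : IsRegion Ω ρ ρlo ρhi R) {D : Set Plane} (hD : D ⊆ Ω)
    (hpos : 0 < mass ρ D) (x : Plane) :
    localCost quadCost ρ D x = localCost quadCost ρ D (centroid ρ D)
      + mass ρ D * ‖x - centroid ρ D‖ ^ 2 := by
  have hexp : ∀ y, localCost quadCost ρ D y = (∫ q in D, ‖q‖ ^ 2 * ρ q) -
      2 * inner ℝ y (∫ q in D, ρ q • q) + ‖y‖ ^ 2 * mass ρ D := by
    intro y
    have i1 := h.integrableOn_normSq.mono_set hD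
    have i2 := h.integrableOn_moment.mono_set hD
    have i3 := h.integrableOn_dens.mono_set hD
    have e : ∀ q, quadCost y q * ρ q =
        ‖q‖ ^ 2 * ρ q - 2 * inner ℝ y (ρ q • q) + ‖y‖ ^ 2 * ρ q := fun q => by
      rw [quadCost, norm_sub_sq_real, inner_smul_right]; ring
    rw [localCost, mass]
    simp_rw [e]
    rw [integral_add, integral_sub, integral_const_mul, integral_const_mul, integral_inner i2]
    · exact i1
    · exact (i2.const_inner y).const_mul 2
    · exact i1.sub ((i2.const_inner y).const_mul 2)
    · exact i3.const_mul _
  have hc : (∫ q in D, ρ q • q) = mass ρ D • centroid ρ D := by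
    rw [centroid, smul_inv_smul₀ hpos.ne']
  rw [hexp x, hexp (centroid ρ D), hc, inner_smul_right, inner_smul_right, norm_sub_sq_real,
    real_inner_self_eq_norm_sq]
  ring

lemma hasGradientAt_localCost (h : IsRegion Ω ρ ρlo ρhi R) {D : Set Plane} (hD : D ⊆ Ω)
    (hpos : 0 < mass ρ D) (x : Plane) :
    HasGradientAt (localCost quadCost ρ D) ((2 * mass ρ D) • (x - centroid ρ D)) x := by
  have e : localCost quadCost ρ D = fun x => localCost quadCost ρ D (centroid ρ D)
      + mass ρ D * ‖x - centroid ρ D‖ ^ 2 := funext (h.localCost_quadCost_eq hD hpos)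
  rw [e, hasGradientAt_iff_hasFDerivAt]
  have h1 := ((((hasFDerivAt_id x).sub_const (centroid ρ D)).norm_sq).const_mul
    (mass ρ D)).const_add (localCost quadCost ρ D (centroid ρ D))
  refine h1.congr_fderiv ?_
  ext v
  simp
  ring

lemma hasFDerivAt_gradient_localCost (h : IsRegion Ω ρ ρlo ρhi R) {D : Set Plane} (hD : D ⊆ Ω)
    (hpos : 0 < mass ρ D) (x : Plane) :
    HasFDerivAt (gradient (localCost quadCost ρ D))
      ((2 * mass ρ D) • ContinuousLinearMap.id ℝ Plane) x := by
  have e : gradient (localCost quadCost ρ D) = fun x => (2 * mass ρ D) • (x - centroid ρ D) :=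
    funext fun x => (h.hasGradientAt_localCost hD hpos x).gradient
  rw [e]
  exact ((hasFDerivAt_id (𝕜 := ℝ) x).sub_const (centroid ρ D)).const_smul (2 * mass ρ D)

lemma localCost_centroid_lt (h : IsRegion Ω ρ ρlo ρhi R) {D : Set Plane} (hD : D ⊆ Ω)
    (hpos : 0 < mass ρ D) {x : Plane} (hx : x ≠ centroid ρ D) :
    localCost quadCost ρ D (centroid ρ D) < localCost quadCost ρ D x := by
  rw [h.localCost_quadCost_eq hD hpos x]
  have : 0 < ‖x - centroid ρ D‖ := norm_pos_iff.2 (sub_ne_zero.2 hx)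
  have : 0 < mass ρ D * ‖x - centroid ρ D‖ ^ 2 := by positivity
  linarith

/-- The gradient 2m(x - c) vanishes only at the centroid c, so the admissible set is B ∩ {c} and the
minimisation is trivial. -/
lemma isLocalOptimum_iff (h : IsRegion Ω ρ ρlo ρhi R) {D : Set Plane} (hD : D ⊆ Ω)
    (hpos : 0 < mass ρ D) (B : Set Plane) (x : Plane) :
    IsLocalOptimum quadCost ρ D B x ↔ x = centroid ρ D ∧ centroid ρ D ∈ B := by
  have hcrit : ∀ y, HasGradientAt (localCost quadCost ρ D) 0 y ↔ y = centroid ρ D := fun y => by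
    constructor
    · intro hy
      have := (h.hasGradientAt_localCost hD hpos y).unique hy
      rwa [smul_eq_zero_iff_right (by positivity), sub_eq_zero] at this
    · rintro rfl
      simpa using h.hasGradientAt_localCost hD hpos (centroid ρ D)
  constructor
  · rintro ⟨⟨hB, hg⟩, -⟩
    have := (hcrit x).1 hg
    exact ⟨this, this ▸ hB⟩
  · rintro ⟨rfl, hB⟩
    refine ⟨⟨hB, (hcrit _).2 rfl⟩, ?_⟩
    rintro y ⟨-, hy⟩
    rw [(hcrit y).1 hy]

end IsRegion

/-! ### Coercivity, Laplacian and energy on the cycle -/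

lemma forall_of_cyclic {N : ℕ} [NeZero N] {P : Fin N → Prop} (h : ∀ i, P (i - 1) → P i)
    {i : Fin N} (hi : P i) (j : Fin N) : P j := by
  have key : ∀ k : ℕ, P (i + Fin.ofNat N k) := by
    intro k
    induction k with
    | zero => simpa using hi
    | succ k ih =>
      apply h
      convert ih using 1
      have : Fin.ofNat N (k + 1) = Fin.ofNat N k + 1 := by
        ext; simp [Fin.val_add]
      rw [this]; abel
  have := key (j - i).val
  rwa [Fin.ofNat_val_eq_self, add_sub_cancel] at this

/-- If consecutive entries of a cyclic vector are related by positive factors and the entries sum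
to zero, then the vector vanishes. -/
lemma eq_zero_of_cyclic {N : ℕ} [NeZero N] {a b e : Fin N → ℝ} (ha : ∀ i, 0 < a i)
    (hb : ∀ i, 0 < b i) (h : ∀ i, a i * e i = b i * e (i - 1)) (hs : ∑ i, e i = 0) : e = 0 := by
  have hpos : ∀ i, ¬ 0 < e i := by
    intro i hi
    have : ∀ j, 0 < e j := forall_of_cyclic (fun j hj => by
      have : 0 < a j * e j := by rw [h j]; exact mul_pos (hb j) hj
      exact pos_of_mul_pos_right this (ha j).le) hi
    have := Finset.sum_pos (fun j _ => this j) (Finset.univ_nonempty (α := Fin N))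
    linarith
  have hneg := (Finset.sum_eq_zero_iff_of_nonpos (fun i _ => not_lt.1 (hpos i))).1 hs
  exact funext fun i => hneg i (Finset.mem_univ i)

/-- Both sides are quadratic in e, so it suffices to treat unit vectors e of zero sum. With the
coefficients in a box this is a compact set, on which the right-hand side attains its minimum;
`eq_zero_of_cyclic` excludes the value zero. -/
lemma exists_cyclic_coercive (N : ℕ) [NeZero N] {c : ℝ} (hc : 0 < c) (C : ℝ) :
    ∃ μ > 0, ∀ a b e : Fin N → ℝ, (∀ i, a i ∈ Set.Icc c C) → (∀ i, b i ∈ Set.Icc c C) →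
      ∑ i, e i = 0 → μ * ∑ i, e i ^ 2 ≤ ∑ i, (a i * e i - b i * e (i - 1)) ^ 2 := by
  let T : Set (Fin N → ℝ) := {e | ∑ i, e i = 0 ∧ ∑ i, e i ^ 2 = 1}
  let B : Set (Fin N → ℝ) := Set.univ.pi fun _ => Set.Icc c C
  have hB : IsCompact B := isCompact_univ_pi fun _ => isCompact_Icc
  have hT : IsCompact T := by
    refine (isCompact_univ_pi fun _ : Fin N => isCompact_Icc (a := (-1 : ℝ)) (b := 1)).of_isClosed_subset
      ?_ ?_
    · exact (isClosed_eq (by fun_prop) continuous_const).inter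
        (isClosed_eq (by fun_prop) continuous_const)
    · rintro e ⟨-, he⟩ i -
      have : e i ^ 2 ≤ 1 := by
        rw [← he]
        exact Finset.single_le_sum (f := fun i => e i ^ 2) (fun j _ => sq_nonneg _) (Finset.mem_univ i)
      exact ⟨by nlinarith, by nlinarith⟩
  let F : (Fin N → ℝ) × (Fin N → ℝ) × (Fin N → ℝ) → ℝ :=
    fun s => ∑ i, (s.1 i * s.2.2 i - s.2.1 i * s.2.2 (i - 1)) ^ 2
  have hF : Continuous F := by fun_prop
  obtain ⟨μ, hμ, hmin⟩ : ∃ μ > 0, ∀ s ∈ B ×ˢ B ×ˢ T, μ ≤ F s := by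
    -- The set is empty when N = 1 or C < c; any positive constant then serves.
    rcases (B ×ˢ B ×ˢ T).eq_empty_or_nonempty with h | h
    · exact ⟨1, one_pos, by simp [h]⟩
    · obtain ⟨s, hs, hmin⟩ := (hB.prod (hB.prod hT)).exists_isMinOn h hF.continuousOn
      refine ⟨F s, ?_, fun y hy => hmin hy⟩
      have h0 : 0 ≤ F s := Finset.sum_nonneg fun i _ => sq_nonneg _
      refine h0.lt_of_ne' fun hz => ?_
      obtain ⟨h1, h2, h3, h4⟩ := hs
      have hz' := (Finset.sum_eq_zero_iff_of_nonneg (fun i _ => sq_nonneg _)).1 hz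
      have : s.2.2 = 0 := eq_zero_of_cyclic (fun i => hc.trans_le (h1 i trivial).1)
        (fun i => hc.trans_le (h2 i trivial).1)
        (fun i => sub_eq_zero.1 (pow_eq_zero_iff two_ne_zero |>.1 (hz' i (Finset.mem_univ i)))) h3
      rw [this] at h4
      simp at h4
  refine ⟨μ, hμ, fun a b e ha hb he => ?_⟩
  set n := ∑ i, e i ^ 2 with hn
  have hn0 : 0 ≤ n := Finset.sum_nonneg fun i _ => sq_nonneg _
  rcases hn0.eq_or_lt with h0 | h0
  · rw [← h0, mul_zero]
    exact Finset.sum_nonneg fun i _ => sq_nonneg _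
  have hsq : (√n)⁻¹ ^ 2 = n⁻¹ := by rw [inv_pow, Real.sq_sqrt hn0]
  have := hmin (a, b, (√n)⁻¹ • e) ⟨fun i _ => ha i, fun i _ => hb i, by
    simp only [Pi.smul_apply, smul_eq_mul]
    rw [← Finset.mul_sum, he, mul_zero], by
    simp only [Pi.smul_apply, smul_eq_mul, mul_pow]
    rw [← Finset.mul_sum, hsq, ← hn, inv_mul_cancel₀ h0.ne']⟩
  have h2 : F (a, b, (√n)⁻¹ • e) = n⁻¹ * ∑ i, (a i * e i - b i * e (i - 1)) ^ 2 := by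
    simp only [F, Pi.smul_apply, smul_eq_mul]
    rw [Finset.mul_sum, ← hsq]
    exact Finset.sum_congr rfl fun i _ => by ring
  rw [h2, inv_mul_eq_div, le_div_iff₀ h0] at this
  exact this

lemma sum_shift {N : ℕ} [NeZero N] {E : Type*} [AddCommMonoid E] (f : Fin N → E) :
    ∑ i, f (i + 1) = ∑ i, f i :=
  Equiv.sum_comp (Equiv.addRight (1 : Fin N)) f

lemma sum_shift_sub {N : ℕ} [NeZero N] {E : Type*} [AddCommMonoid E] (f : Fin N → E) :
    ∑ i, f (i - 1) = ∑ i, f i :=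
  Equiv.sum_comp (Equiv.subRight (1 : Fin N)) f

/-- The Laplacian of the cycle. -/
def cyclicLaplacian {N : ℕ} [NeZero N] {E : Type*} [AddCommGroup E] [Module ℝ E] (f : Fin N → E)
    (i : Fin N) : E := (2 : ℝ) • f i - f (i - 1) - f (i + 1)

/-- The index `i + 1 - 1` is left unsimplified so that the second bracket is literally the shift of
the first, ready for `sum_shift`. -/
lemma cyclicLaplacian_eq {N : ℕ} [NeZero N] {E : Type*} [AddCommGroup E] [Module ℝ E]
    (f : Fin N → E) (i : Fin N) :
    cyclicLaplacian f i = (f i - f (i - 1)) - (f (i + 1) - f (i + 1 - 1)) := by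
  rw [cyclicLaplacian, add_sub_cancel_right, two_smul]; abel

lemma sum_cyclicLaplacian {N : ℕ} [NeZero N] {E : Type*} [AddCommGroup E] [Module ℝ E]
    (f : Fin N → E) : ∑ i, cyclicLaplacian f i = 0 := by
  simp_rw [cyclicLaplacian_eq]
  rw [Finset.sum_sub_distrib, sum_shift (fun i => f i - f (i - 1)), sub_self]

/-- Summation by parts on the cycle. -/
lemma sum_inner_sub_sub {N : ℕ} [NeZero N] {E : Type*} [NormedAddCommGroup E]
    [InnerProductSpace ℝ E] (f g : Fin N → E) :
    ∑ i, inner ℝ (f i - f (i - 1)) (g i - g (i - 1)) = ∑ i, inner ℝ (cyclicLaplacian f i) (g i) := by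
  let d : Fin N → E := fun i => f i - f (i - 1)
  have h1 : ∀ i, inner ℝ (f i - f (i - 1)) (g i - g (i - 1))
      = inner ℝ (d i) (g i) - inner ℝ (d i) (g (i - 1)) := fun i => inner_sub_right _ _ _
  have h2 : ∀ i, inner ℝ (cyclicLaplacian f i) (g i)
      = inner ℝ (d i) (g i) - inner ℝ (d (i + 1)) (g (i + 1 - 1)) := fun i => by
    rw [cyclicLaplacian_eq, add_sub_cancel_right i 1]
    simp only [d, add_sub_cancel_right, inner_sub_left]
  simp_rw [h1, h2]
  rw [Finset.sum_sub_distrib, Finset.sum_sub_distrib,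
    sum_shift fun i => inner ℝ (d i) (g (i - 1))]

/-- The deviation of a cyclic configuration from a constant one. -/
noncomputable def cyclicEnergy {N : ℕ} [NeZero N] {E : Type*} [NormedAddCommGroup E]
    (f : Fin N → E) : ℝ := ∑ i, ‖f i - f (i - 1)‖ ^ 2

lemma cyclicEnergy_nonneg {N : ℕ} [NeZero N] {E : Type*} [NormedAddCommGroup E]
    (f : Fin N → E) : 0 ≤ cyclicEnergy f := Finset.sum_nonneg fun _ _ => sq_nonneg _

lemma norm_sub_le_sqrt_cyclicEnergy {N : ℕ} [NeZero N] {E : Type*} [NormedAddCommGroup E]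
    (f : Fin N → E) (i : Fin N) : ‖f i - f (i - 1)‖ ≤ √(cyclicEnergy f) :=
  Real.le_sqrt_of_sq_le (Finset.single_le_sum (f := fun i => ‖f i - f (i - 1)‖ ^ 2)
    (fun _ _ => sq_nonneg _) (Finset.mem_univ i))

lemma norm_cyclicLaplacian_le {N : ℕ} [NeZero N] {E : Type*} [NormedAddCommGroup E]
    [NormedSpace ℝ E] (f : Fin N → E) (i : Fin N) :
    ‖cyclicLaplacian f i‖ ≤ 2 * √(cyclicEnergy f) := by
  rw [cyclicLaplacian_eq, two_mul]
  exact (norm_sub_le _ _).trans (add_le_add (norm_sub_le_sqrt_cyclicEnergy f i)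
    (norm_sub_le_sqrt_cyclicEnergy f (i + 1)))

/-- The spectral gap of the cycle. -/
lemma exists_spectral_gap (N : ℕ) [NeZero N] : ∃ μ > 0, ∀ f : Fin N → ℝ,
    μ * cyclicEnergy f ≤ ∑ i, cyclicLaplacian f i ^ 2 := by
  -- Unit coefficients, applied to the differences f i - f (i - 1), which sum to zero; up to sign
  -- and a shift, their own differences are the Laplacian.
  obtain ⟨μ, hμ, h⟩ := exists_cyclic_coercive N one_pos 1
  refine ⟨μ, hμ, fun f => ?_⟩
  have h1 := h 1 1 (fun i => f i - f (i - 1)) (by simp) (by simp) (by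
    rw [Finset.sum_sub_distrib, sum_shift_sub, sub_self])
  simp only [cyclicEnergy, Real.norm_eq_abs, sq_abs, cyclicLaplacian_eq]
  refine h1.trans_eq ?_
  rw [← sum_shift]
  refine Finset.sum_congr rfl fun i _ => ?_
  simp only [Pi.one_apply, one_mul, add_sub_cancel_right]
  ring

lemma cyclicEnergy_plane {N : ℕ} [NeZero N] (r : Fin N → Plane) :
    cyclicEnergy r = cyclicEnergy (fun i => r i 0) + cyclicEnergy fun i => r i 1 := by
  simp only [cyclicEnergy, Real.norm_eq_abs, sq_abs, norm_sq_coord, PiLp.sub_apply,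
    Finset.sum_add_distrib]

lemma spectral_gap_plane {N : ℕ} [NeZero N] {μ : ℝ}
    (h : ∀ f : Fin N → ℝ, μ * cyclicEnergy f ≤ ∑ i, cyclicLaplacian f i ^ 2)
    (r : Fin N → Plane) : μ * cyclicEnergy r ≤ ∑ i, ‖cyclicLaplacian r i‖ ^ 2 := by
  rw [cyclicEnergy_plane, mul_add]
  refine (add_le_add (h _) (h _)).trans_eq ?_
  rw [← Finset.sum_add_distrib]
  refine Finset.sum_congr rfl fun i _ => ?_
  rw [norm_sq_coord]
  rfl

/-- The energy dissipation of the partition dynamics controls the energy. -/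
lemma exists_dissipation_bound (N : ℕ) [NeZero N] {c : ℝ} (hc : 0 < c) (C G : ℝ) {κφ κr : ℝ}
    (hκφ : 0 < κφ) (hκr : 0 < κr) :
    ∃ μ > 0, ∀ (a b m : Fin N → ℝ) (g r : Fin N → Plane), (∀ i, a i ∈ Set.Icc c C) →
      (∀ i, b i ∈ Set.Icc c C) → (∀ i, ‖g i‖ ≤ G) →
      μ * (cyclicEnergy m + cyclicEnergy r) ≤
        κφ * ∑ i, (a i * cyclicLaplacian m i - b i * cyclicLaplacian m (i - 1)) ^ 2 +
        κr * ∑ i, ‖cyclicLaplacian m i • g i + cyclicLaplacian r i‖ ^ 2 := by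
  obtain ⟨μ₁, hμ₁, h₁⟩ := exists_cyclic_coercive N hc C
  obtain ⟨μ₂, hμ₂, h₂⟩ := exists_spectral_gap N
  -- Only the fraction `lam` of the reference point term is kept, so that the loss `lam * κr * G ^ 2
  -- * P` from the cross terms takes at most half of `κφ * μ₁ * P`. The `+ 1` keeps the denominator
  -- positive when G = 0.
  set lam := min 1 (κφ * μ₁ / (2 * κr * (G ^ 2 + 1))) with hlam
  have hlam0 : 0 < lam := lt_min one_pos (by positivity)
  have hlam1 : lam ≤ 1 := min_le_left _ _
  have hlam2 : lam * κr * G ^ 2 ≤ κφ * μ₁ / 2 := by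
    have h3 : lam ≤ κφ * μ₁ / (2 * κr * (G ^ 2 + 1)) := min_le_right _ _
    rw [le_div_iff₀ (by positivity)] at h3
    nlinarith [mul_pos hlam0 hκr]
  refine ⟨min (κφ * μ₁ / 2) (lam * κr / 2) * μ₂, by positivity, fun a b m g r ha hb hg => ?_⟩
  have e1 := h₁ a b (cyclicLaplacian m) ha hb (sum_cyclicLaplacian m)
  have e2 := h₂ m
  have e3 := spectral_gap_plane h₂ r
  set P := ∑ i, cyclicLaplacian m i ^ 2
  set Q := ∑ i, ‖cyclicLaplacian r i‖ ^ 2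
  -- Termwise this is ‖v‖² ≤ 2‖u + v‖² + 2‖u‖².
  have e4 : Q / 2 - G ^ 2 * P ≤ ∑ i, ‖cyclicLaplacian m i • g i + cyclicLaplacian r i‖ ^ 2 := by
    rw [Finset.mul_sum, Finset.sum_div, ← Finset.sum_sub_distrib]
    refine Finset.sum_le_sum fun i _ => ?_
    set u := cyclicLaplacian m i • g i
    set v := cyclicLaplacian r i
    have hu : ‖u‖ ^ 2 ≤ G ^ 2 * cyclicLaplacian m i ^ 2 := by
      rw [norm_smul, mul_pow, Real.norm_eq_abs, sq_abs, mul_comm]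
      exact mul_le_mul_of_nonneg_right (pow_le_pow_left₀ (norm_nonneg _) (hg i) 2) (sq_nonneg _)
    have hv : ‖v‖ ≤ ‖u + v‖ + ‖u‖ := by
      simpa using norm_sub_le (u + v) u
    nlinarith [norm_nonneg v, norm_nonneg u, norm_nonneg (u + v), sq_nonneg (‖u + v‖ - ‖u‖)]
  set S := ∑ i, ‖cyclicLaplacian m i • g i + cyclicLaplacian r i‖ ^ 2
  have hS : 0 ≤ S := Finset.sum_nonneg fun _ _ => sq_nonneg _
  have hP : 0 ≤ P := Finset.sum_nonneg fun _ _ => sq_nonneg _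
  have hQ : 0 ≤ Q := Finset.sum_nonneg fun _ _ => sq_nonneg _
  calc _ ≤ min (κφ * μ₁ / 2) (lam * κr / 2) * (P + Q) := by
        rw [mul_assoc, mul_add μ₂]
        exact mul_le_mul_of_nonneg_left (add_le_add e2 e3) (by positivity)
    _ ≤ κφ * μ₁ / 2 * P + lam * κr / 2 * Q := by
        rw [mul_add]
        exact add_le_add (mul_le_mul_of_nonneg_right (min_le_left _ _) hP)
          (mul_le_mul_of_nonneg_right (min_le_right _ _) hQ)
    _ ≤ κφ * (μ₁ * P) + lam * κr * (Q / 2 - G ^ 2 * P) := by nlinarith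
    _ ≤ κφ * (μ₁ * P) + lam * κr * S := by
        have := mul_le_mul_of_nonneg_left e4 (mul_pos hlam0 hκr).le
        linarith
    _ ≤ _ := by
        have h5 := mul_le_mul_of_nonneg_left e1 hκφ.le
        have h6 : lam * κr * S ≤ κr * S := by
          rw [mul_assoc]; exact mul_le_of_le_one_left (by positivity) hlam1
        linarith

/-! ### Derivatives on a half-line -/

/-- The function exp (μ t) * H t is antitone. -/
lemma exp_decay_of_deriv_le {H H' : ℝ → ℝ} {μ : ℝ}
    (hd : ∀ t, 0 ≤ t → HasDerivWithinAt H (H' t) (Set.Ici 0) t)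
    (hle : ∀ t, 0 ≤ t → H' t ≤ -μ * H t) {t : ℝ} (ht : 0 ≤ t) :
    H t ≤ H 0 * Real.exp (-μ * t) := by
  have hd' : ∀ t, 0 ≤ t → HasDerivWithinAt (fun s => Real.exp (μ * s) * H s)
      (Real.exp (μ * t) * (μ * H t + H' t)) (Set.Ici 0) t := fun t ht => by
    have h1 : HasDerivAt (fun s => Real.exp (μ * s)) (Real.exp (μ * t) * μ) t := by
      simpa using ((hasDerivAt_id t).const_mul μ).exp
    refine (h1.hasDerivWithinAt.mul (hd t ht)).congr_deriv ?_
    ring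
  have hanti : AntitoneOn (fun s => Real.exp (μ * s) * H s) (Set.Ici 0) := by
    refine antitoneOn_of_deriv_nonpos (convex_Ici 0) (fun t ht => (hd' t ht).continuousWithinAt)
      (fun t ht => ?_) fun t ht => ?_
    · rw [interior_Ici] at ht ⊢
      exact ((hd' t (le_of_lt ht)).hasDerivAt (Ici_mem_nhds ht)).differentiableAt.differentiableWithinAt
    · rw [interior_Ici] at ht
      rw [((hd' t (le_of_lt ht)).hasDerivAt (Ici_mem_nhds ht)).deriv]
      have := hle t (le_of_lt ht)
      exact mul_nonpos_of_nonneg_of_nonpos (Real.exp_pos _).le (by linarith)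
  have h2 := hanti (Set.mem_Ici.2 le_rfl) (Set.mem_Ici.2 ht) ht
  simp only [mul_zero, Real.exp_zero, one_mul] at h2
  rw [neg_mul, Real.exp_neg, ← div_eq_mul_inv, le_div_iff₀ (Real.exp_pos _)]
  linarith

/-- A mean value inequality in place of integration: no continuity or integrability of f' is needed.
-/
lemma norm_sub_le_of_deriv_le {E : Type*} [NormedAddCommGroup E] [NormedSpace ℝ E] {f f' : ℝ → E}
    {B B' : ℝ → ℝ} {a b : ℝ} (ha : 0 ≤ a) (hab : a ≤ b)
    (hf : ∀ t, 0 ≤ t → HasDerivWithinAt f (f' t) (Set.Ici 0) t)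
    (hB : ∀ t, HasDerivAt B (B' t) t) (hle : ∀ t, a ≤ t → ‖f' t‖ ≤ B' t) :
    ‖f b - f a‖ ≤ B b - B a := by
  refine image_norm_le_of_norm_deriv_right_le_deriv_boundary (f := fun t => f t - f a)
    (f' := f') (B := fun t => B t - B a) (B' := B') (a := a) (b := b) ?_ ?_ (by simp) ?_ ?_ ⟨hab, le_rfl⟩
  · exact fun t ht => (((hf t (ha.trans ht.1)).continuousWithinAt).mono
      fun s hs => ha.trans hs.1).sub continuousWithinAt_const
  · exact fun t ht => ((hf t (ha.trans ht.1)).mono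
      fun s hs => (ha.trans ht.1).trans hs).sub_const _
  · exact fun t => (hB t).sub_const _
  · exact fun t ht => hle t ht.1

/-- The increments of f are dominated by those of the convergent antiderivative B, so f is Cauchy at
infinity. -/
lemma exists_tendsto_of_deriv_exp_decay {E : Type*} [NormedAddCommGroup E] [NormedSpace ℝ E]
    [CompleteSpace E] {f f' : ℝ → E} {C ν : ℝ} (hν : 0 < ν)
    (hf : ∀ t, 0 ≤ t → HasDerivWithinAt f (f' t) (Set.Ici 0) t)
    (hle : ∀ t, 0 ≤ t → ‖f' t‖ ≤ C * Real.exp (-ν * t)) : ∃ y, Tendsto f atTop (𝓝 y) := by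
  let B : ℝ → ℝ := fun t => -(C / ν) * Real.exp (-ν * t)
  have hB : ∀ t, HasDerivAt B (C * Real.exp (-ν * t)) t := fun t => by
    have h1 : HasDerivAt (fun s => Real.exp (-ν * s)) (Real.exp (-ν * t) * -ν) t := by
      simpa using ((hasDerivAt_id t).const_mul (-ν)).exp
    refine (h1.const_mul (-(C / ν))).congr_deriv ?_
    field_simp
  have hBlim : Tendsto B atTop (𝓝 0) := by
    have h1 : Tendsto (fun t : ℝ => -ν * t) atTop atBot :=
      tendsto_id.const_mul_atTop_of_neg (neg_lt_zero.2 hν)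
    simpa [B] using (Real.tendsto_exp_atBot.comp h1).const_mul (-(C / ν))
  refine cauchy_map_iff_exists_tendsto.1 (Metric.cauchy_iff.2 ⟨inferInstance, fun ε hε => ?_⟩)
  obtain ⟨T, hT⟩ := eventually_atTop.1 (hBlim.eventually (Metric.ball_mem_nhds 0 (show 0 < ε / 4 by positivity)))
  refine ⟨f '' Set.Ici (max T 0), image_mem_map (Ici_mem_atTop _), ?_⟩
  have key : ∀ t ∈ Set.Ici (max T 0), ‖f t - f (max T 0)‖ < ε / 2 := fun t ht => by
    refine (norm_sub_le_of_deriv_le (le_max_right T 0) ht hf hB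
      fun s hs => hle s ((le_max_right T 0).trans hs)).trans_lt ?_
    have h1 := abs_lt.1 (mem_ball_zero_iff.1 (hT t ((le_max_left T 0).trans ht)))
    have h2 := abs_lt.1 (mem_ball_zero_iff.1 (hT _ (le_max_left T 0)))
    linarith [h1.2, h2.1]
  rintro _ ⟨s, hs, rfl⟩ _ ⟨t, ht, rfl⟩
  rw [dist_eq_norm]
  have h1 := norm_sub_le_norm_sub_add_norm_sub (f s) (f (max T 0)) (f t)
  rw [norm_sub_rev (f (max T 0))] at h1
  linarith [key s hs, key t ht]

/-- Proportional feedback towards a convergent target converges to the limit of the target. -/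
lemma tendsto_of_control {κp : ℝ} (hκp : 0 < κp) {p c : ℝ → Plane} {c₀ : Plane}
    (hp : ∀ t, 0 ≤ t → HasDerivWithinAt p (control κp (p t) (c t)) (Set.Ici 0) t)
    (hc : Tendsto c atTop (𝓝 c₀)) : Tendsto p atTop (𝓝 c₀) := by
  -- The integrating factor exp (κp t) removes p from the right-hand side.
  have hF : ∀ t, 0 ≤ t → HasDerivWithinAt (fun s => Real.exp (κp * s) • (p s - c₀))
      ((Real.exp (κp * t) * κp) • (c t - c₀)) (Set.Ici 0) t := fun t ht => by
    have h1 : HasDerivAt (fun s => Real.exp (κp * s)) (Real.exp (κp * t) * κp) t := by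
      simpa using ((hasDerivAt_id t).const_mul κp).exp
    refine (h1.hasDerivWithinAt.smul ((hp t ht).sub_const c₀)).congr_deriv ?_
    rw [control]
    module
  rw [Metric.tendsto_atTop]
  intro ε hε
  obtain ⟨T, hT⟩ := eventually_atTop.1 (hc.eventually (Metric.ball_mem_nhds c₀ (half_pos hε)))
  set T' := max T 0
  have hB : ∀ t, HasDerivAt (fun s => ε / 2 * Real.exp (κp * s))
      (ε / 2 * (Real.exp (κp * t) * κp)) t := fun t => by
    have h1 : HasDerivAt (fun s => Real.exp (κp * s)) (Real.exp (κp * t) * κp) t := by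
      simpa using ((hasDerivAt_id t).const_mul κp).exp
    exact h1.const_mul _
  have key : ∀ t, T' ≤ t → ‖p t - c₀‖ ≤
      Real.exp (-κp * t) * ‖Real.exp (κp * T') • (p T' - c₀)‖ + ε / 2 := fun t ht => by
    have h1 := norm_sub_le_of_deriv_le (le_max_right T 0) ht hF hB fun s hs => by
      have h2 := mem_ball_iff_norm.1 (hT s ((le_max_left T 0).trans hs))
      rw [norm_smul, Real.norm_of_nonneg (by positivity), mul_comm]
      exact mul_le_mul_of_nonneg_right h2.le (by positivity)
    have h3 : ‖Real.exp (κp * t) • (p t - c₀)‖ ≤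
        ‖Real.exp (κp * T') • (p T' - c₀)‖ + ε / 2 * Real.exp (κp * t) := by
      have h4 := norm_le_norm_add_norm_sub' (Real.exp (κp * t) • (p t - c₀))
        (Real.exp (κp * T') • (p T' - c₀))
      have : 0 < ε / 2 * Real.exp (κp * T') := by positivity
      linarith
    rw [norm_smul, Real.norm_of_nonneg (Real.exp_pos _).le] at h3
    rw [neg_mul, Real.exp_neg, inv_mul_eq_div, div_add' _ _ _ (Real.exp_pos _).ne',
      le_div_iff₀ (Real.exp_pos _), mul_comm]
    exact h3
  have hlim : Tendsto (fun t => Real.exp (-κp * t) * ‖Real.exp (κp * T') • (p T' - c₀)‖) atTop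
      (𝓝 0) := by
    have h1 : Tendsto (fun t : ℝ => -κp * t) atTop atBot :=
      tendsto_id.const_mul_atTop_of_neg (neg_lt_zero.2 hκp)
    simpa using (Real.tendsto_exp_atBot.comp h1).mul_const ‖Real.exp (κp * T') • (p T' - c₀)‖
  obtain ⟨T₂, hT₂⟩ := eventually_atTop.1 (hlim.eventually (gt_mem_nhds (half_pos hε)))
  refine ⟨max T' T₂, fun t ht => ?_⟩
  rw [dist_eq_norm]
  have h1 := key t ((le_max_left _ _).trans ht)
  have h2 := hT₂ t ((le_max_right _ _).trans ht)
  linarith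

/-! ### Partial derivatives of the workloads -/

section Workload

variable {N : ℕ} [NeZero N] {Ω : Set Plane} {ρ : Plane → ℝ} {ρlo ρhi R δ : ℝ}
  {φ : Fin N → ℝ} {r : Fin N → Plane}

/-- The differences telescope around the cycle; only the wrap-around index leaves a full turn. -/
lemma sum_opening (φ : Fin N → ℝ) : ∑ i, (nextAngle φ i - φ i) = 2 * Real.pi := by
  simp only [nextAngle, Finset.sum_sub_distrib, Finset.sum_add_distrib, sum_shift φ]
  rw [sum_shift fun i : Fin N => if i = 0 then 2 * Real.pi else 0]
  simp

lemma nextAngle_le (h : ∀ i, φ i ≤ nextAngle φ i) (i : Fin N) :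
    nextAngle φ i ≤ φ i + 2 * Real.pi := by
  have := Finset.single_le_sum (f := fun i => nextAngle φ i - φ i)
    (fun j _ => sub_nonneg.2 (h j)) (Finset.mem_univ i)
  rw [sum_opening] at this
  linarith

/-- The hypothesis means N ≥ 2: the two pointers that bound a sector are then independent variables.
-/
lemma add_one_ne_self (hN : (1 : Fin N) ≠ 0) (i : Fin N) : i + 1 ≠ i := by
  simpa using hN

lemma workload_update_self (hN : (1 : Fin N) ≠ 0) (i : Fin N) (s : ℝ) :
    workload Ω ρ (Function.update φ i s) r i
      = mass ρ (Ω ∩ sector (r i) s (nextAngle φ i)) := by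
  rw [workload, subregion, nextAngle, Function.update_self,
    Function.update_of_ne (add_one_ne_self hN i), nextAngle]

lemma workload_update_next (hN : (1 : Fin N) ≠ 0) (i : Fin N) (s : ℝ) :
    workload Ω ρ (Function.update φ (i + 1) s) r i
      = mass ρ (Ω ∩ sector (r i) (φ i) (s + if i + 1 = 0 then 2 * Real.pi else 0)) := by
  rw [workload, subregion, nextAngle, Function.update_self,
    Function.update_of_ne (add_one_ne_self hN i).symm]

lemma workload_update_of_ne {i j : Fin N} (h : i ≠ j) (h' : i ≠ j + 1) (s : ℝ) :
    workload Ω ρ (Function.update φ i s) r j = workload Ω ρ φ r j := by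
  rw [workload, subregion, nextAngle, Function.update_of_ne h.symm, Function.update_of_ne h'.symm]
  rfl

lemma workload_update_point (i : Fin N) (x : Plane) :
    workload Ω ρ φ (Function.update r i x) i
      = mass ρ (Ω ∩ sector x (φ i) (nextAngle φ i)) := by
  rw [workload, subregion, Function.update_self]

lemma workload_update_point_of_ne {i j : Fin N} (h : i ≠ j) (x : Plane) :
    workload Ω ρ φ (Function.update r i x) j = workload Ω ρ φ r j := by
  rw [workload, subregion, Function.update_of_ne h.symm]
  rfl

variable {j : Fin N}

lemma hasDerivAt_workload_phase
    (hd : DifferentiableAt ℝ (fun s : (Fin N → ℝ) × (Fin N → Plane) => workload Ω ρ s.1 s.2 j)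
      (φ, r)) (i : Fin N) :
    HasDerivAt (fun s => workload Ω ρ (Function.update φ i s) r j)
      (fderiv ℝ (fun s : (Fin N → ℝ) × (Fin N → Plane) => workload Ω ρ s.1 s.2 j) (φ, r)
        (Pi.single i 1, 0)) (φ i) := by
  have h1 : HasDerivAt (fun s => (Function.update φ i s, r)) (Pi.single i 1, 0) (φ i) :=
    (hasDerivAt_update φ i (φ i)).prodMk (hasDerivAt_const _ _)
  have h2 := hd.hasFDerivAt
  exact HasFDerivAt.comp_hasDerivAt_of_eq (φ i) h2 h1 (by rw [Function.update_eq_self])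

lemma hasFDerivAt_workload_point
    (hd : DifferentiableAt ℝ (fun s : (Fin N → ℝ) × (Fin N → Plane) => workload Ω ρ s.1 s.2 j)
      (φ, r)) (i : Fin N) :
    HasFDerivAt (fun x => workload Ω ρ φ (Function.update r i x) j)
      ((fderiv ℝ (fun s : (Fin N → ℝ) × (Fin N → Plane) => workload Ω ρ s.1 s.2 j) (φ, r)).comp
        ((0 : Plane →L[ℝ] (Fin N → ℝ)).prod
          (ContinuousLinearMap.pi (Pi.single i (ContinuousLinearMap.id ℝ Plane))))) (r i) := by
  have h1 : HasFDerivAt (fun x => (φ, Function.update r i x))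
      ((0 : Plane →L[ℝ] (Fin N → ℝ)).prod
        (ContinuousLinearMap.pi (Pi.single i (ContinuousLinearMap.id ℝ Plane)))) (r i) :=
    (hasFDerivAt_const _ _).prodMk (hasFDerivAt_update r (r i))
  have h2 : HasFDerivAt (fun s : (Fin N → ℝ) × (Fin N → Plane) => workload Ω ρ s.1 s.2 j)
      (fderiv ℝ (fun s : (Fin N → ℝ) × (Fin N → Plane) => workload Ω ρ s.1 s.2 j) (φ, r))
      (φ, Function.update r i (r i)) := by
    rw [Function.update_eq_self]
    exact hd.hasFDerivAt
  exact h2.comp (r i) h1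

lemma fderiv_workload_point_apply
    (hd : DifferentiableAt ℝ (fun s : (Fin N → ℝ) × (Fin N → Plane) => workload Ω ρ s.1 s.2 j)
      (φ, r)) (i : Fin N) (y : Plane) :
    fderiv ℝ (fun s : (Fin N → ℝ) × (Fin N → Plane) => workload Ω ρ s.1 s.2 j) (φ, r)
        (0, Pi.single i y)
      = fderiv ℝ (fun x => workload Ω ρ φ (Function.update r i x) j) (r i) y := by
  rw [(hasFDerivAt_workload_point hd i).fderiv]
  simp only [ContinuousLinearMap.comp_apply, ContinuousLinearMap.prod_apply,
    zero_apply]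
  congr 2
  ext k : 1
  rw [ContinuousLinearMap.pi_apply]
  by_cases hk : k = i
  · subst hk; simp
  · simp [Pi.single_eq_of_ne hk]

/-- The workload of an agent depends only on its two pointers and its reference point. -/
lemma fderiv_workload_apply (hN : (1 : Fin N) ≠ 0)
    (hd : DifferentiableAt ℝ (fun s : (Fin N → ℝ) × (Fin N → Plane) => workload Ω ρ s.1 s.2 j)
      (φ, r)) (u : Fin N → ℝ) (y : Fin N → Plane) :
    fderiv ℝ (fun s : (Fin N → ℝ) × (Fin N → Plane) => workload Ω ρ s.1 s.2 j) (φ, r) (u, y)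
      = u j * workloadDerivPhase Ω ρ φ r j j + u (j + 1) * workloadDerivPhase Ω ρ φ r j (j + 1)
        + inner ℝ (workloadGradPoint Ω ρ φ r j) (y j) := by
  set L := fderiv ℝ (fun s : (Fin N → ℝ) × (Fin N → Plane) => workload Ω ρ s.1 s.2 j) (φ, r)
  have hP : ∀ i, workloadDerivPhase Ω ρ φ r j i = L (Pi.single i 1, 0) := fun i =>
    (hasDerivAt_workload_phase hd i).deriv
  have hP0 : ∀ i, i ≠ j → i ≠ j + 1 → L (Pi.single i 1, 0) = 0 := fun i h h' => by
    rw [← hP, workloadDerivPhase]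
    simp_rw [workload_update_of_ne h h']
    exact deriv_const _ _
  have hG0 : ∀ i, i ≠ j → ∀ y, L (0, Pi.single i y) = 0 := fun i h y => by
    rw [fderiv_workload_point_apply hd]
    simp_rw [workload_update_point_of_ne h]
    simp
  have hu : L (u, 0) = ∑ i, u i * L (Pi.single i 1, 0) := by
    have : (u, (0 : Fin N → Plane)) = ∑ i, u i • ((Pi.single i 1, 0) :
        (Fin N → ℝ) × (Fin N → Plane)) := by
      refine Prod.ext ?_ ?_
      · rw [Prod.fst_sum]
        simpa using pi_eq_sum_univ' u
      · rw [Prod.snd_sum]; simp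
    rw [this, map_sum]
    simp only [map_smul, smul_eq_mul]
  have hy : L (0, y) = ∑ i, L (0, Pi.single i (y i)) := by
    have : ((0 : Fin N → ℝ), y) = ∑ i, ((0, Pi.single i (y i)) :
        (Fin N → ℝ) × (Fin N → Plane)) := by
      refine Prod.ext ?_ ?_
      · rw [Prod.fst_sum]; simp
      · rw [Prod.snd_sum]
        exact (Finset.univ_sum_single y).symm
    rw [this, map_sum]
  have hsplit : ((u, y) : (Fin N → ℝ) × (Fin N → Plane)) = (u, 0) + (0, y) := by simp
  rw [hsplit, map_add, hu, hy, hP, hP]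
  congr 1
  · rw [Finset.sum_eq_add_of_mem j (j + 1) (Finset.mem_univ _) (Finset.mem_univ _)
      (add_one_ne_self hN j).symm]
    rintro i - ⟨h1, h2⟩
    rw [hP0 i h1 h2, mul_zero]
  · rw [Finset.sum_eq_single_of_mem j (Finset.mem_univ _) fun i _ h => hG0 i h _,
      fderiv_workload_point_apply hd, workloadGradPoint, gradient,
      InnerProductSpace.toDual_symm_apply]

lemma hasDerivAt_workloadDerivPhase
    (hd : DifferentiableAt ℝ (fun s : (Fin N → ℝ) × (Fin N → Plane) => workload Ω ρ s.1 s.2 j)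
      (φ, r)) (i : Fin N) :
    HasDerivAt (fun s => workload Ω ρ (Function.update φ i s) r j)
      (workloadDerivPhase Ω ρ φ r j i) (φ i) :=
  (hasDerivAt_workload_phase hd i).differentiableAt.hasDerivAt

end Workload

/-! ### Uniform bounds on the workload derivatives -/

/-- Where the derivative is known to exist, one-sided slopes determine it. It is thus enough to move
a pointer inwards, which splits the sector into a remainder and a swept slice. -/
lemma le_of_hasDerivAt_of_left {f : ℝ → ℝ} {f' x c : ℝ} (hf : HasDerivAt f f' x)
    (h : ∀ᶠ s in 𝓝[<] x, c * (x - s) ≤ f x - f s) : c ≤ f' := by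
  have h1 := (hasDerivWithinAt_iff_tendsto_slope' (s := Set.Iio x) (by simp)).1
    hf.hasDerivWithinAt
  refine ge_of_tendsto h1 ?_
  filter_upwards [h, self_mem_nhdsWithin] with s hs hlt
  have hlt : s < x := hlt
  rw [slope_comm, slope_def_field, le_div_iff₀ (by linarith)]
  exact hs

lemma le_neg_of_hasDerivAt_of_right {f : ℝ → ℝ} {f' x c : ℝ} (hf : HasDerivAt f f' x)
    (h : ∀ᶠ s in 𝓝[>] x, c * (s - x) ≤ f x - f s) : c ≤ -f' := by
  have h1 := (hasDerivWithinAt_iff_tendsto_slope' (s := Set.Ioi x) (by simp)).1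
    hf.hasDerivWithinAt
  refine ge_of_tendsto h1.neg ?_
  filter_upwards [h, self_mem_nhdsWithin] with s hs hlt
  have hlt : x < s := hlt
  rw [slope_def_field, ← neg_div, le_div_iff₀ (by linarith)]
  linarith

namespace IsRegion

variable {N : ℕ} [NeZero N] {Ω : Set Plane} {ρ : Plane → ℝ} {ρlo ρhi R δ : ℝ}
  {φ : Fin N → ℝ} {r : Fin N → Plane}

lemma abs_mass_sub_angles_le (h : IsRegion Ω ρ ρlo ρhi R) {x : Plane} (hx : ‖x‖ ≤ R)
    (α β α' β' : ℝ) :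
    ‖mass ρ (Ω ∩ sector x α β) - mass ρ (Ω ∩ sector x α' β')‖
      ≤ 16 * R ^ 2 * ρhi * (|α - α'| + |β - β'|) :=
  norm_integral_sector_sub_angles_le h.meas h.norm_le h.hi_pos.le h.integrableOn_dens
    h.norm_dens_le hx _ _ _ _

/-- From below, the slice swept by the pointer has mass at least proportional to its opening
(`le_mass_sector`); from above, the workload is Lipschitz in the angle. -/
lemma neg_workloadDerivPhase_self_mem (h : IsRegion Ω ρ ρlo ρhi R) (hN : (1 : Fin N) ≠ 0)
    (hδ : 0 < δ) {i : Fin N} (hr : Metric.ball (r i) δ ⊆ Ω) (hord : ∀ i, φ i < nextAngle φ i)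
    (hd : DifferentiableAt ℝ (fun s : (Fin N → ℝ) × (Fin N → Plane) => workload Ω ρ s.1 s.2 i)
      (φ, r)) :
    -workloadDerivPhase Ω ρ φ r i i ∈ Set.Icc (ρlo * (δ ^ 2 / 128)) (16 * R ^ 2 * ρhi) := by
  have hx : ‖r i‖ ≤ R := h.norm_le _ (hr (Metric.mem_ball_self hδ))
  have hle := nextAngle_le (fun i => (hord i).le) i
  have hi := h.hi_pos
  constructor
  · refine le_neg_of_hasDerivAt_of_right (hasDerivAt_workloadDerivPhase hd i) ?_
    filter_upwards [Ioo_mem_nhdsGT (hord i)] with s hs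
    rw [workload_update_self hN, workload_update_self hN]
    have h1 := h.mass_sector_add_le ((norm_nonneg _).trans hx) (x := r i) hs.1.le hs.2.le hle
    have h2 := h.le_mass_sector hδ hr hs.1.le (by linarith [hs.2])
    linarith
  · refine (le_abs_self _).trans ?_
    rw [abs_neg, workloadDerivPhase, ← Real.norm_eq_abs]
    refine norm_deriv_le_of_lip' (by positivity) (Eventually.of_forall fun s => ?_)
    rw [workload_update_self hN, workload_update_self hN]
    refine (h.abs_mass_sub_angles_le hx _ _ _ _).trans_eq ?_
    rw [sub_self, abs_zero, add_zero, Real.norm_eq_abs]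

lemma workloadDerivPhase_next_mem (h : IsRegion Ω ρ ρlo ρhi R) (hN : (1 : Fin N) ≠ 0)
    (hδ : 0 < δ) {i : Fin N} (hr : Metric.ball (r i) δ ⊆ Ω) (hord : ∀ i, φ i < nextAngle φ i)
    (hd : DifferentiableAt ℝ (fun s : (Fin N → ℝ) × (Fin N → Plane) => workload Ω ρ s.1 s.2 i)
      (φ, r)) :
    workloadDerivPhase Ω ρ φ r i (i + 1) ∈
      Set.Icc (ρlo * (δ ^ 2 / 128)) (16 * R ^ 2 * ρhi) := by
  have hx : ‖r i‖ ≤ R := h.norm_le _ (hr (Metric.mem_ball_self hδ))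
  have hle := nextAngle_le (fun i => (hord i).le) i
  have hi := h.hi_pos
  constructor
  · refine le_of_hasDerivAt_of_left (hasDerivAt_workloadDerivPhase hd (i + 1)) ?_
    have hlt := hord i
    rw [nextAngle] at hlt hle
    filter_upwards [Ioo_mem_nhdsLT (sub_lt_iff_lt_add.2 hlt)] with s hs
    rw [workload_update_next hN, workload_update_next hN]
    have hs1 := sub_lt_iff_lt_add.1 hs.1
    have hs2 := hs.2
    have h1 := h.mass_sector_add_le ((norm_nonneg _).trans hx) (x := r i) hs1.le
      (add_le_add_left hs2.le (if i + 1 = 0 then 2 * Real.pi else 0)) hle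
    have h2 := h.le_mass_sector hδ hr
      (add_le_add_left hs2.le (if i + 1 = 0 then 2 * Real.pi else 0)) (by linarith)
    rw [add_sub_add_right_eq_sub] at h2
    linarith
  · refine (le_abs_self _).trans ?_
    rw [workloadDerivPhase, ← Real.norm_eq_abs]
    refine norm_deriv_le_of_lip' (by positivity) (Eventually.of_forall fun s => ?_)
    rw [workload_update_next hN, workload_update_next hN]
    refine (h.abs_mass_sub_angles_le hx _ _ _ _).trans_eq ?_
    rw [sub_self, abs_zero, zero_add, add_sub_add_right_eq_sub, Real.norm_eq_abs]

/-- A Lipschitz bound suffices, without differentiability, because `gradient` is zero by default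
elsewhere. -/
lemma norm_workloadGradPoint_le (h : IsRegion Ω ρ ρlo ρhi R) (hR0 : 0 ≤ R) (φ : Fin N → ℝ)
    (r : Fin N → Plane) (i : Fin N) :
    ‖workloadGradPoint Ω ρ φ r i‖ ≤ 16 * R * ρhi := by
  have hi := h.hi_pos
  rw [workloadGradPoint, gradient, LinearIsometryEquiv.norm_map]
  refine norm_fderiv_le_of_lip' ℝ (by positivity) (Eventually.of_forall fun x => ?_)
  rw [workload_update_point, workload_update_point]
  exact norm_integral_sector_sub_apex_le h.meas h.norm_le hR0 h.hi_pos.le h.integrableOn_dens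
    h.norm_dens_le _ _ _ _

lemma workload_ge (h : IsRegion Ω ρ ρlo ρhi R) (hδ : 0 < δ) (hord : ∀ i, φ i ≤ nextAngle φ i)
    (i : Fin N) (hr : Metric.ball (r i) δ ⊆ Ω) :
    ρlo * (δ ^ 2 / 128) * (nextAngle φ i - φ i) ≤ workload Ω ρ φ r i :=
  h.le_mass_sector hδ hr (hord i) (nextAngle_le hord i)

lemma workload_pos (h : IsRegion Ω ρ ρlo ρhi R) (hδ : 0 < δ) (hord : ∀ i, φ i < nextAngle φ i)
    (i : Fin N) (hr : Metric.ball (r i) δ ⊆ Ω) : 0 < workload Ω ρ φ r i := by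
  refine lt_of_lt_of_le ?_ (h.workload_ge hδ (fun i => (hord i).le) i hr)
  have := h.lo_pos
  have := sub_pos.2 (hord i)
  positivity

/-- Made for the limit state, where the cyclic order is only weak and a sector might collapse. Equal
workloads would all be nonpositive together, against the openings that sum to 2π. -/
lemma workload_pos_of_balanced (h : IsRegion Ω ρ ρlo ρhi R) (hδ : 0 < δ)
    (hord : ∀ i, φ i ≤ nextAngle φ i) (hr : ∀ i, Metric.ball (r i) δ ⊆ Ω)
    (hbal : ∀ i, workload Ω ρ φ r (i - 1) = workload Ω ρ φ r i) (i : Fin N) :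
    0 < workload Ω ρ φ r i := by
  by_contra! hle
  have hall : ∀ j, workload Ω ρ φ r j ≤ 0 :=
    forall_of_cyclic (fun j hj => by rwa [← hbal j]) hle
  have hs := Finset.sum_le_sum fun j (_ : j ∈ Finset.univ) =>
    (h.workload_ge hδ hord j (hr j)).trans (hall j)
  rw [← Finset.mul_sum, sum_opening, Finset.sum_const_zero] at hs
  have := h.lo_pos
  have := Real.pi_pos
  have : 0 < ρlo * (δ ^ 2 / 128) * (2 * Real.pi) := by positivity
  linarith

end IsRegion

/-! ### Dissipation and exponential decay along the flow -/

section Dynamics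

variable {N : ℕ} [NeZero N] {Ω : Set Plane} {ρ : Plane → ℝ} {κφ κr : ℝ}

lemma sub_two_eq (i : Fin N) : i - 2 = i - 1 - 1 := by
  have : (2 : Fin N) = 1 + 1 := by ext; simp [Fin.val_add]
  rw [this, sub_add_eq_sub_sub]

lemma phaseVelocity_eq (φ : Fin N → ℝ) (r : Fin N → Plane) (i : Fin N) :
    phaseVelocity Ω ρ κφ φ r i = κφ *
      (-workloadDerivPhase Ω ρ φ r i i * cyclicLaplacian (workload Ω ρ φ r) i
        - workloadDerivPhase Ω ρ φ r (i - 1) i * cyclicLaplacian (workload Ω ρ φ r) (i - 1)) := by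
  simp only [phaseVelocity, cyclicLaplacian, sub_two_eq, sub_add_cancel, smul_eq_mul]
  ring

lemma pointVelocity_eq (φ : Fin N → ℝ) (r : Fin N → Plane) (i : Fin N) :
    pointVelocity Ω ρ κr φ r i = (-κr) •
      (cyclicLaplacian (workload Ω ρ φ r) i • workloadGradPoint Ω ρ φ r i
        + cyclicLaplacian r i) := rfl

lemma hasDerivWithinAt_cyclicEnergy {E : Type*} [NormedAddCommGroup E] [InnerProductSpace ℝ E]
    {f : ℝ → Fin N → E} {f' : Fin N → E} {S : Set ℝ} {t : ℝ}
    (h : ∀ i, HasDerivWithinAt (fun s => f s i) (f' i) S t) :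
    HasDerivWithinAt (fun s => cyclicEnergy (f s))
      (2 * ∑ i, inner ℝ (cyclicLaplacian (f t) i) (f' i)) S t := by
  rw [← sum_inner_sub_sub, Finset.mul_sum]
  exact HasDerivWithinAt.fun_sum fun i _ => ((h i).sub (h (i - 1))).norm_sq

namespace IsPartitionSolution

variable {φ : ℝ → Fin N → ℝ} {r : ℝ → Fin N → Plane}

lemma hasDerivWithinAt_workload (hsol : IsPartitionSolution Ω ρ κφ κr φ r)
    (hN : (1 : Fin N) ≠ 0) {t : ℝ} (ht : 0 ≤ t) (i : Fin N) :
    HasDerivWithinAt (fun s => workload Ω ρ (φ s) (r s) i)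
      (phaseVelocity Ω ρ κφ (φ t) (r t) i * workloadDerivPhase Ω ρ (φ t) (r t) i i
        + phaseVelocity Ω ρ κφ (φ t) (r t) (i + 1) *
          workloadDerivPhase Ω ρ (φ t) (r t) i (i + 1)
        + inner ℝ (workloadGradPoint Ω ρ (φ t) (r t) i) (pointVelocity Ω ρ κr (φ t) (r t) i))
      (Set.Ici 0) t := by
  have hs : HasDerivWithinAt (fun s => (φ s, r s))
      (phaseVelocity Ω ρ κφ (φ t) (r t), pointVelocity Ω ρ κr (φ t) (r t)) (Set.Ici 0) t :=
    (hasDerivWithinAt_pi.2 (hsol.phase t ht)).prodMk (hasDerivWithinAt_pi.2 (hsol.point t ht))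
  have hd := hsol.differentiable t ht i
  rw [← fderiv_workload_apply hN hd]
  exact hd.hasFDerivAt.comp_hasDerivWithinAt t hs

/-- Along the partition dynamics the energy is dissipated. -/
lemma hasDerivWithinAt_energy (hsol : IsPartitionSolution Ω ρ κφ κr φ r)
    (hN : (1 : Fin N) ≠ 0) {t : ℝ} (ht : 0 ≤ t) :
    HasDerivWithinAt (fun s => cyclicEnergy (workload Ω ρ (φ s) (r s)) + cyclicEnergy (r s))
      (-2 * (κφ * ∑ i, (-workloadDerivPhase Ω ρ (φ t) (r t) i i *
          cyclicLaplacian (workload Ω ρ (φ t) (r t)) i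
          - workloadDerivPhase Ω ρ (φ t) (r t) (i - 1) i *
            cyclicLaplacian (workload Ω ρ (φ t) (r t)) (i - 1)) ^ 2 +
        κr * ∑ i, ‖cyclicLaplacian (workload Ω ρ (φ t) (r t)) i •
          workloadGradPoint Ω ρ (φ t) (r t) i + cyclicLaplacian (r t) i‖ ^ 2)) (Set.Ici 0) t := by
  refine ((hasDerivWithinAt_cyclicEnergy (hsol.hasDerivWithinAt_workload hN ht)).add
    (hasDerivWithinAt_cyclicEnergy (hsol.point t ht))).congr_deriv ?_
  set e := cyclicLaplacian (workload Ω ρ (φ t) (r t))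
  set l := cyclicLaplacian (r t)
  set P := workloadDerivPhase Ω ρ (φ t) (r t) with hP
  set g := workloadGradPoint Ω ρ (φ t) (r t) with hg
  set v := phaseVelocity Ω ρ κφ (φ t) (r t) with hv
  set w := pointVelocity Ω ρ κr (φ t) (r t) with hw
  -- Regrouping by pointer instead of by sector: the contribution of pointer i + 1 to sector i is
  -- reindexed, so that v i multiplies the partial derivative of the energy in its own angle.
  have h1 : ∑ i, inner ℝ (e i) (v i * P i i + v (i + 1) * P i (i + 1) + inner ℝ (g i) (w i))
      = ∑ i, (v i * (P i i * e i + P (i - 1) i * e (i - 1)) + e i * inner ℝ (g i) (w i)) := by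
    have h2 := sum_shift fun i => v i * (P (i - 1) i * e (i - 1))
    simp only [add_sub_cancel_right] at h2
    simp_rw [mul_add (v _)]
    rw [Finset.sum_add_distrib, Finset.sum_add_distrib, ← h2, ← Finset.sum_add_distrib,
      ← Finset.sum_add_distrib]
    refine Finset.sum_congr rfl fun i _ => ?_
    rw [RCLike.inner_apply, conj_trivial]
    ring
  rw [h1, ← mul_add, ← Finset.sum_add_distrib, neg_mul, ← mul_neg, Finset.mul_sum _ _ κφ,
    Finset.mul_sum _ _ κr, ← Finset.sum_add_distrib, ← Finset.sum_neg_distrib]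
  congr 1
  refine Finset.sum_congr rfl fun i _ => ?_
  rw [hv, hw, phaseVelocity_eq, pointVelocity_eq, inner_smul_right, inner_smul_right,
    ← real_inner_self_eq_norm_sq, inner_add_left (e i • g i), real_inner_smul_left]
  ring

/-- Dissipation gives dH/dt ≤ -2μH, hence √H decays at rate μ. The velocities are linear in the two
Laplacians with bounded coefficients, so they are O(√H), as are the workload differences. -/
lemma exists_velocity_decay {ρlo ρhi R δ : ℝ} (hreg : IsRegion Ω ρ ρlo ρhi R) (hR0 : 0 ≤ R)
    (hκφ : 0 < κφ) (hκr : 0 < κr) (hsol : IsPartitionSolution Ω ρ κφ κr φ r) (hδ : 0 < δ)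
    (hball : ∀ t, 0 ≤ t → ∀ i, Metric.ball (r t i) δ ⊆ Ω) :
    ∃ C, ∃ ν > 0, ∀ t, 0 ≤ t → ∀ i,
      ‖phaseVelocity Ω ρ κφ (φ t) (r t) i‖ ≤ C * Real.exp (-ν * t) ∧
      ‖pointVelocity Ω ρ κr (φ t) (r t) i‖ ≤ C * Real.exp (-ν * t) ∧
      ‖workload Ω ρ (φ t) (r t) i - workload Ω ρ (φ t) (r t) (i - 1)‖
        ≤ C * Real.exp (-ν * t) := by
  -- For N = 1 both Laplacians vanish and nothing moves.
  by_cases hN : (1 : Fin N) = 0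
  · refine ⟨0, 1, one_pos, fun t ht i => ?_⟩
    have hl : ∀ {E : Type} [AddCommGroup E] [Module ℝ E] (f : Fin N → E) (i : Fin N),
        cyclicLaplacian f i = 0 := fun f i => by
      simp [cyclicLaplacian, hN, two_smul]
    simp [phaseVelocity_eq, pointVelocity_eq, hl, hN]
  set c := ρlo * (δ ^ 2 / 128) with hc
  set C₁ := 16 * R ^ 2 * ρhi with hC₁
  set G := 16 * R * ρhi with hG
  have hc0 : 0 < c := by have := hreg.lo_pos; positivity
  have hhi := hreg.hi_pos
  obtain ⟨μ, hμ, hdis⟩ := exists_dissipation_bound N hc0 C₁ G hκφ hκr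
  have ha := fun t ht i => hreg.neg_workloadDerivPhase_self_mem hN hδ (hball t ht i)
    (hsol.ordered t ht) (hsol.differentiable t ht i)
  have hb : ∀ t, 0 ≤ t → ∀ i, workloadDerivPhase Ω ρ (φ t) (r t) (i - 1) i ∈ Set.Icc c C₁ :=
    fun t ht i => by
      have := hreg.workloadDerivPhase_next_mem hN hδ (hball t ht (i - 1))
        (hsol.ordered t ht) (hsol.differentiable t ht (i - 1))
      rwa [sub_add_cancel] at this
  have hg := fun t i => hreg.norm_workloadGradPoint_le hR0 (φ t) (r t) i
  set H : ℝ → ℝ := fun s => cyclicEnergy (workload Ω ρ (φ s) (r s)) + cyclicEnergy (r s) with hH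
  have hdecay : ∀ t, 0 ≤ t → H t ≤ H 0 * Real.exp (-(2 * μ) * t) := fun t ht => by
    refine exp_decay_of_deriv_le (fun t ht => hsol.hasDerivWithinAt_energy hN ht)
      (fun t ht => ?_) ht
    have := hdis _ _ (workload Ω ρ (φ t) (r t)) _ (r t) (ha t ht) (hb t ht) (hg t)
    linarith
  have hsqrt : ∀ t, 0 ≤ t → √(H t) ≤ √(H 0) * Real.exp (-μ * t) := fun t ht => by
    refine (Real.sqrt_le_sqrt (hdecay t ht)).trans_eq ?_
    have : Real.exp (-(2 * μ) * t) = Real.exp (-μ * t) ^ 2 := by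
      rw [← Real.exp_nat_mul]; congr 1; push_cast; ring
    rw [this, Real.sqrt_mul' _ (sq_nonneg _), Real.sqrt_sq (Real.exp_pos _).le]
  -- The sum of the factors of √H in the three bounds, so that one constant serves all of them.
  set A := κφ * (4 * C₁) + κr * (2 * G + 2) + 1 with hA
  have hG0 : 0 ≤ G := by positivity
  have hC0 : 0 ≤ C₁ := by positivity
  have hscale : ∀ t, 0 ≤ t → ∀ B y, B ≤ A → y ≤ B * √(H t) →
      y ≤ A * √(H 0) * Real.exp (-μ * t) := fun t ht B y hB hy => by
    refine hy.trans ((mul_le_mul_of_nonneg_right hB (Real.sqrt_nonneg _)).trans ?_)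
    rw [mul_assoc]
    exact mul_le_mul_of_nonneg_left (hsqrt t ht) (by positivity)
  refine ⟨A * √(H 0), μ, hμ, fun t ht i => ?_⟩
  have hm : √(cyclicEnergy (workload Ω ρ (φ t) (r t))) ≤ √(H t) :=
    Real.sqrt_le_sqrt (le_add_of_nonneg_right (cyclicEnergy_nonneg _))
  have hr : √(cyclicEnergy (r t)) ≤ √(H t) :=
    Real.sqrt_le_sqrt (le_add_of_nonneg_left (cyclicEnergy_nonneg _))
  have he : ∀ i, ‖cyclicLaplacian (workload Ω ρ (φ t) (r t)) i‖ ≤ 2 * √(H t) := fun i =>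
    (norm_cyclicLaplacian_le _ i).trans (by linarith)
  have hl : ‖cyclicLaplacian (r t) i‖ ≤ 2 * √(H t) :=
    (norm_cyclicLaplacian_le _ i).trans (by linarith)
  have hnorm : ∀ x ∈ Set.Icc c C₁, ‖x‖ ≤ C₁ := fun x hx => by
    rw [Real.norm_of_nonneg (hc0.le.trans hx.1)]; exact hx.2
  refine ⟨hscale t ht (κφ * (4 * C₁)) _ ?_ ?_, hscale t ht (κr * (2 * G + 2)) _ ?_ ?_,
    hscale t ht 1 _ ?_ ?_⟩
  · have : 0 ≤ κr * (2 * G + 2) := by positivity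
    linarith
  · rw [phaseVelocity_eq, norm_mul, Real.norm_of_nonneg hκφ.le, mul_assoc]
    refine mul_le_mul_of_nonneg_left ((norm_sub_le _ _).trans ?_) hκφ.le
    rw [norm_mul, norm_mul]
    have h1 := mul_le_mul (hnorm _ (ha t ht i)) (he i) (norm_nonneg _) hC0
    have h2 := mul_le_mul (hnorm _ (hb t ht i)) (he (i - 1)) (norm_nonneg _) hC0
    linarith
  · have : 0 ≤ κφ * (4 * C₁) := by positivity
    linarith
  · rw [pointVelocity_eq, norm_smul, norm_neg, Real.norm_of_nonneg hκr.le, mul_assoc]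
    refine mul_le_mul_of_nonneg_left ((norm_add_le _ _).trans ?_) hκr.le
    rw [norm_smul]
    have h1 := mul_le_mul (he i) (hg t i) (norm_nonneg _) (by positivity)
    linarith
  · have : 0 ≤ κr * (2 * G + 2) := by positivity
    have : 0 ≤ κφ * (4 * C₁) := by positivity
    linarith
  · rw [one_mul]
    exact (norm_sub_le_sqrt_cyclicEnergy _ i).trans hm

end IsPartitionSolution

end Dynamics

end Coverage

/-! ### Convergence of the partition and of the positions -/

/-- `φ`, `r`, `p` are the phase angles, the reference points and the positions of the agents, and
`pstar` their local optima for the quadratic cost. The reference points stay in a compact subset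
of the interior of the coverage region. The sets `A t i` of allowed positions are arbitrary; the
subregions themselves are a particular case. -/
theorem corollary2 {N : ℕ} [NeZero N]
    (Ω : Set Plane) (hΩb : Bornology.IsBounded Ω) (hΩm : MeasurableSet Ω)
    (ρ : Plane → ℝ) (hρm : AEMeasurable ρ (volume.restrict Ω))
    (ρlo ρhi : ℝ) (hρlo : 0 < ρlo) (hρ : ∀ q ∈ Ω, ρlo ≤ ρ q ∧ ρ q ≤ ρhi)
    (κφ κr κp : ℝ) (hκφ : 0 < κφ) (hκr : 0 < κr) (hκp : 0 < κp)
    (φ : ℝ → Fin N → ℝ) (r : ℝ → Fin N → Plane)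
    (hsol : IsPartitionSolution Ω ρ κφ κr φ r)
    (K : Set Plane) (hK : IsCompact K) (hKΩ : K ⊆ interior Ω)
    (hrK : ∀ t, 0 ≤ t → ∀ i, r t i ∈ K)
    (A : ℝ → Fin N → Set Plane) (pstar : ℝ → Fin N → Plane)
    (hpstar : ∀ t, 0 ≤ t → ∀ i,
      IsLocalOptimum quadCost ρ (subregion Ω (φ t) (r t) i) (A t i) (pstar t i))
    (p : ℝ → Fin N → Plane)
    (hp : ∀ t, 0 ≤ t → ∀ i, HasDerivWithinAt (fun s => p s i)
      (control κp (p t i) (pstar t i)) (Set.Ici 0) t) :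
    -- the local optimum is the centroid
    (∀ t, 0 ≤ t → ∀ i,
      let D := subregion Ω (φ t) (r t) i
      0 < mass ρ D ∧
      (∀ x, HasGradientAt (localCost quadCost ρ D) ((2 * mass ρ D) • (x - centroid ρ D)) x) ∧
      (∀ x, HasFDerivAt (gradient (localCost quadCost ρ D))
        ((2 * mass ρ D) • ContinuousLinearMap.id ℝ Plane) x) ∧
      (∀ x, x ≠ centroid ρ D →
        localCost quadCost ρ D (centroid ρ D) < localCost quadCost ρ D x) ∧
      (∀ B x, IsLocalOptimum quadCost ρ D B x ↔ x = centroid ρ D ∧ centroid ρ D ∈ B) ∧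
      pstar t i = centroid ρ D) ∧
    -- each agent approaches the moving centroid of its subregion
    (∀ i, Tendsto (fun t => ‖p t i - centroid ρ (subregion Ω (φ t) (r t) i)‖) atTop (𝓝 0)) ∧
    -- the partition converges, and each agent converges to the centroid of the limit subregion
    ∃ (φlim : Fin N → ℝ) (rlim : Fin N → Plane),
      (∀ i, Tendsto (fun t => φ t i) atTop (𝓝 (φlim i))) ∧
      (∀ i, Tendsto (fun t => r t i) atTop (𝓝 (rlim i))) ∧
      ∀ i, 0 < mass ρ (subregion Ω φlim rlim i) ∧
        Tendsto (fun t => p t i) atTop (𝓝 (centroid ρ (subregion Ω φlim rlim i))) := by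
  
  -- The reference point of some agent shows that Ω is nonempty, whence ρlo ≤ ρhi and R ≥ 0.
  obtain ⟨i₀⟩ : Nonempty (Fin N) := inferInstance
  -- Compactness of K gives one radius δ for all times and agents; every later bound is uniform
  -- because of it.
  obtain ⟨δ, hδ, hthick⟩ := hK.exists_cthickening_subset_open isOpen_interior hKΩ
  have hballK : ∀ x ∈ K, Metric.ball x δ ⊆ Ω := fun x hx =>
    (Metric.ball_subset_thickening hx δ).trans
      ((Metric.thickening_subset_cthickening δ K).trans (hthick.trans interior_subset))
  have hball : ∀ t, 0 ≤ t → ∀ i, Metric.ball (r t i) δ ⊆ Ω := fun t ht i =>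
    hballK _ (hrK t ht i)
  obtain ⟨R, hR⟩ := hΩb.subset_closedBall 0
  have hKΩ' : ∀ x ∈ K, x ∈ Ω := fun x hx => interior_subset (hKΩ hx)
  have hreg : IsRegion Ω ρ ρlo ρhi R :=
    { meas := hΩm
      dens := hρm
      norm_le := fun q hq => mem_closedBall_zero_iff.1 (hR hq)
      lo_pos := hρlo
      lo_le := fun q hq => (hρ q hq).1
      le_hi := fun q hq => (hρ q hq).2
      lo_le_hi := by
        have := hρ _ (hKΩ' _ (hrK 0 le_rfl i₀))
        exact this.1.trans this.2 }
  have hnormK : ∀ x ∈ K, ‖x‖ ≤ R := fun x hx => hreg.norm_le x (hKΩ' x hx)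
  have hR0 : 0 ≤ R := (norm_nonneg _).trans (hnormK _ (hrK 0 le_rfl i₀))
  have hpos : ∀ t, 0 ≤ t → ∀ i, 0 < mass ρ (subregion Ω (φ t) (r t) i) := fun t ht i =>
    hreg.workload_pos hδ (hsol.ordered t ht) i (hball t ht i)
  have hsub : ∀ (φ : Fin N → ℝ) (r : Fin N → Plane) i, subregion Ω φ r i ⊆ Ω :=
    fun _ _ _ => Set.inter_subset_left
  have hstar : ∀ t, 0 ≤ t → ∀ i, pstar t i = centroid ρ (subregion Ω (φ t) (r t) i) :=
    fun t ht i => ((hreg.isLocalOptimum_iff (hsub _ _ i) (hpos t ht i) _ _).1 (hpstar t ht i)).1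
  obtain ⟨C, ν, hν, hdecay⟩ := hsol.exists_velocity_decay hreg hR0 hκφ hκr hδ hball
  choose φlim hφlim using fun i => exists_tendsto_of_deriv_exp_decay hν
    (fun t ht => hsol.phase t ht i) fun t ht => (hdecay t ht i).1
  choose rlim hrlim using fun i => exists_tendsto_of_deriv_exp_decay hν
    (fun t ht => hsol.point t ht i) fun t ht => (hdecay t ht i).2.1
  have hrlimK : ∀ i, rlim i ∈ K := fun i => hK.isClosed.mem_of_tendsto (hrlim i)
    ((eventually_ge_atTop 0).mono fun t ht => hrK t ht i)
  have hnext : ∀ i, Tendsto (fun t => nextAngle (φ t) i) atTop (𝓝 (nextAngle φlim i)) :=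
    fun i => (hφlim (i + 1)).add_const _
  have hmass : ∀ i, Tendsto (fun t => workload Ω ρ (φ t) (r t) i) atTop
      (𝓝 (workload Ω ρ φlim rlim i)) := fun i =>
    hreg.tendsto_mass_sector (hnormK _ (hrlimK i)) (hrlim i) (hφlim i) (hnext i)
  have hbal : ∀ i, workload Ω ρ φlim rlim (i - 1) = workload Ω ρ φlim rlim i := fun i => by
    have h1 := (hmass i).sub (hmass (i - 1))
    have h2 : Tendsto (fun t => C * Real.exp (-ν * t)) atTop (𝓝 0) := by
      simpa using (Real.tendsto_exp_atBot.comp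
        (tendsto_id.const_mul_atTop_of_neg (neg_lt_zero.2 hν))).const_mul C
    have h3 : Tendsto (fun t => workload Ω ρ (φ t) (r t) i - workload Ω ρ (φ t) (r t) (i - 1))
        atTop (𝓝 0) := squeeze_zero_norm'
      ((eventually_ge_atTop 0).mono fun t ht => (hdecay t ht i).2.2) h2
    exact (sub_eq_zero.1 (tendsto_nhds_unique h1 h3)).symm
  -- The strict order of the pointers passes to the limit only as ≤, so positivity is drawn from the
  -- balance of the limit workloads.
  have hposlim : ∀ i, 0 < mass ρ (subregion Ω φlim rlim i) :=
    hreg.workload_pos_of_balanced hδ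
      (fun i => le_of_tendsto_of_tendsto (hφlim i) (hnext i)
        ((eventually_ge_atTop 0).mono fun t ht => (hsol.ordered t ht i).le))
      (fun i => hballK _ (hrlimK i)) hbal
  have hcent : ∀ i, Tendsto (fun t => centroid ρ (subregion Ω (φ t) (r t) i)) atTop
      (𝓝 (centroid ρ (subregion Ω φlim rlim i))) := fun i =>
    hreg.tendsto_centroid_sector (hnormK _ (hrlimK i)) (hposlim i) (hrlim i) (hφlim i) (hnext i)
  have hplim : ∀ i, Tendsto (fun t => p t i) atTop
      (𝓝 (centroid ρ (subregion Ω φlim rlim i))) := fun i =>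
    tendsto_of_control hκp (fun t ht => hstar t ht i ▸ hp t ht i) (hcent i)
  refine ⟨fun t ht i => ⟨hpos t ht i, hreg.hasGradientAt_localCost (hsub _ _ i) (hpos t ht i),
    hreg.hasFDerivAt_gradient_localCost (hsub _ _ i) (hpos t ht i),
    fun x hx => hreg.localCost_centroid_lt (hsub _ _ i) (hpos t ht i) hx,
    hreg.isLocalOptimum_iff (hsub _ _ i) (hpos t ht i), hstar t ht i⟩, fun i => ?_,
    φlim, rlim, hφlim, hrlim, fun i => ⟨hposlim i, hplim i⟩⟩
  simpa using ((hplim i).sub (hcent i)).norm
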